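/- For $n\ge 0$ let $\Gamma_n^*\subseteq\mathbb R^{2^n}$ be the set of entropic vectors, i.e. of the vectors $h=(h(\alpha))_{\alpha\subseteq[n]}$ with $h(\alpha)=H(X_\alpha)$ (binary Shannon entropy) for some jointly distributed random variables $X_1,\dots,X_n$ with finite domains, and let $\overline{\Gamma_n^*}$ be its topological closure. The information-inequality problem $\mathsf{IIP}$ is: given $n$ and $c\in\mathbb Z^{2^n}$, decide whether $c\cdot h=\sum_{\alpha\subseteq[n]}c_\alpha h(\alpha)\ge 0$ for all $h\in\Gamma_n^*$. The max-information-inequality problem $\mathsf{MaxIIP}$ is: given $n$ and a finite family $c_1,\dots,c_k\in\mathbb Z^{2^n}$, decide whether $\max_j (c_j\cdot h)\ge 0$ for all $h\in\Gamma_n^*$. For $j\in[n]$ let $h^{(j)}(\alpha)=1$ if $j\in\alpha$ and $h^{(j)}(\alpha)=0$ otherwise. Call a family $d_1,\dots,d_k\in\mathbb R^{2^n}$ *group balanced* if (a) the $k\times n$ matrix $A_{ij}=d_i\cdot h^{(j)}$ has rank $k-1$, and (b) there is a modular function $h^{(*)}$ (that is, $h^{(*)}(\emptyset)=0$ and $h^{(*)}(\alpha)+h^{(*)}(\beta)=h^{(*)}(\alpha\cup\beta)+h^{(*)}(\alpha\cap\beta)$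 for all $\alpha,\beta\subseteq[n]$) that is positive, i.e. $h^{(*)}(\alpha)>0$ for every nonempty $\alpha$, and satisfies $d_i\cdot h^{(*)}=0$ for all $i$. Then $\mathsf{MaxIIP}$ restricted to group-balanced families (the set of pairs of a number $n$ and a group-balanced family of integer vectors whose max-inequality is valid) is Turing equivalent to $\mathsf{IIP}$. The same holds when $\Gamma_n^*$ is replaced by $\overline{\Gamma_n^*}$ in both problems. -/

import Mathlib

namespace InfoIneq

/-- A vector of `ℝ^(2^n)`: one real coordinate for each subset of the `n` variables. -/
abbrev SetVec (n : ℕ) : Type := Finset (Fin n) → ℝ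

/-- Binary entropy of a probability mass function on a finite set (with `0 log 0 = 0`). -/
noncomputable def entropy {D : Type} [Fintype D] (p : D → ℝ) : ℝ :=
  -∑ x, p x * Real.logb 2 (p x)

/-- The probability mass function of the sub-tuple `(X_i : i ∈ α)` of random variables
`X_0, …, X_{n-1}` with domains `Fin (N i)` and joint probability mass function `p`. -/
def marginal {n : ℕ} {N : Fin n → ℕ} (p : ((i : Fin n) → Fin (N i)) → ℝ)
    (α : Finset (Fin n)) : ((i : α) → Fin (N i)) → ℝ :=
  fun y => ∑ x : (i : Fin n) → Fin (N i) with (∀ i : α, x i = y i), p x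

/-- The set `Γₙ*` of entropic vectors: the vectors `h(α) = H(X_α)` of the joint distributions of
`n` random variables with finite domains (a domain with `N` elements is taken to be `Fin N`). -/
def entropicRegion (n : ℕ) : Set (SetVec n) :=
  {h | ∃ (N : Fin n → ℕ) (p : ((i : Fin n) → Fin (N i)) → ℝ),
    (∀ x, 0 ≤ p x) ∧ ∑ x, p x = 1 ∧ ∀ α, h α = entropy (marginal p α)}

/-- The set of almost entropic vectors: the topological closure of `Γₙ*`. -/
def almostEntropicRegion (n : ℕ) : Set (SetVec n) :=
  closure (entropicRegion n)

/-- The dot product `c · h = ∑_{α ⊆ [n]} c_α h(α)`. -/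
def dot {n : ℕ} (c h : SetVec n) : ℝ := ∑ α, c α * h α

/-- The max information inequality `max_j (c_j · h) ≥ 0`, that is `⋁_j (c_j · h ≥ 0)`, holds
for all `h ∈ S`. -/
def MaxValid {n k : ℕ} (S : Set (SetVec n)) (c : Fin k → SetVec n) : Prop :=
  ∀ h ∈ S, ∃ j, 0 ≤ dot (c j) h

/-- The information inequality `c · h ≥ 0` holds for all `h ∈ S`. -/
def Valid {n : ℕ} (S : Set (SetVec n)) (c : SetVec n) : Prop :=
  ∀ h ∈ S, 0 ≤ dot c h

/-- The basic modular function of the variable `j`. -/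
def basicModular {n : ℕ} (j : Fin n) : SetVec n := fun α => if j ∈ α then 1 else 0

/-- Modular set functions (with the convention `h(∅) = 0`). -/
def IsModular {n : ℕ} (h : SetVec n) : Prop :=
  h ∅ = 0 ∧ ∀ α β, h α + h β = h (α ∪ β) + h (α ∩ β)

/-- A family of `k` vectors is group balanced if the `k × n` matrix `A_ij = d_i · h^(j)` has rank
`k - 1`, and some modular function that is positive on the nonempty sets is orthogonal to all
`d_i`. -/
def IsGroupBalanced {n k : ℕ} (d : Fin k → SetVec n) : Prop :=
  (Matrix.of fun (i : Fin k) (j : Fin n) => dot (d i) (basicModular j)).rank + 1 = k ∧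
  ∃ h : SetVec n, IsModular h ∧ (∀ α, α.Nonempty → 0 < h α) ∧ ∀ i, dot (d i) h = 0

/-- The vector of `ℤ^(2^n)` written as a list of `2^n` integers: the coordinate at `α` stands at
the position whose binary digits are the indicator of `α`. -/
def coeffs (n : ℕ) (l : List ℤ) : SetVec n :=
  fun α => ((l.getD (∑ i ∈ α, 2 ^ (i : ℕ)) 0 : ℤ) : ℝ)

/-- The problem `IIP` over the regions `S n`: an instance is a number `n` of variables with a
vector `c ∈ ℤ^(2^n)`; the question is whether `c · h ≥ 0` for all `h ∈ S n`. -/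
def IIP (S : (n : ℕ) → Set (SetVec n)) : ℕ × List ℤ → Prop :=
  fun x => x.2.length = 2 ^ x.1 ∧ Valid (S x.1) (coeffs x.1 x.2)

/-- The problem `MaxIIP` over the regions `S n`, restricted to group-balanced families: an
instance is a number `n` of variables with a finite group-balanced family of vectors
`c_j ∈ ℤ^(2^n)`; the question is whether `max_j (c_j · h) ≥ 0` for all `h ∈ S n`. -/
def GroupBalancedMaxIIP (S : (n : ℕ) → Set (SetVec n)) : ℕ × List (List ℤ) → Prop :=
  fun x => (∀ l ∈ x.2, l.length = 2 ^ x.1) ∧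
    IsGroupBalanced (fun j : Fin x.2.length => coeffs x.1 (x.2.get j)) ∧
    MaxValid (S x.1) (fun j : Fin x.2.length => coeffs x.1 (x.2.get j))

open Classical in
/-- The characteristic function of a decision problem, on the codes of its instances. -/
noncomputable def charFun {I : Type} [Primcodable I] (P : I → Prop) : ℕ →. ℕ :=
  fun m => Part.some (if ∃ x : I, Encodable.decode m = some x ∧ P x then 1 else 0)

end InfoIneq

/-! Validity of an inequality or max-inequality defines a closed set of vectors, so passing to the
closure changes neither problem, and only Γ* needs attention. Both Turing reductions are in fact
many-one reductions.

From IIP to MaxIIP. A valid `c` has weights c·h^(j) ≥ 0, and subtracting (c·h^(j)) h(j | rest) for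
every j leaves a valid inequality whose weights are all zero; the converse holds because h(j | rest)
≥ 0. This is `valid_iff_balanced`. A single vector with zero weights is a group-balanced family. The
hard point is that validity survives the subtraction (`Valid.sub_private`). Take N independent
copies of the variables and extract from the i-th one almost all of its information that is private
given the others, by a leftover hash (`exists_hash`). Conditioning on the extracted V removes N h(i
| rest) from the entropies of the sets containing i and almost nothing from the others, up to O(log
N) (`exists_cond`). A valid inequality holds for conditional entropies too; divide by N and let N
grow.

From MaxIIP to IIP. The closure of the set of vectors with an entropic positive multiple is a convex
cone, so by Hahn-Banach a max-inequality is valid iff some nonnegative w ≠ 0 makes ∑ w_j d_j valid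
(`maxValid_iff`). Evaluating at h^(j) gives wA ≥ 0, and pairing with the positive modular function
forces wA = 0. Since A has rank k - 1, its left kernel is a line. If it contains a nonzero
nonnegative vector w, the max-inequality is equivalent to the one inequality ∑ w_j d_j; otherwise it
fails.

To find w and to decide group balancedness, the reduction searches for an integral certificate. Such
certificates exist for every instance (`certificate_alternatives`), because real solutions of
homogeneous integer systems are approximated by rational ones, and checking them is primitive
recursive. -/

namespace InfoIneq

open Classical in
/-- The probability of the event that `f` takes the value which it takes at `ω`. -/
noncomputable def mass {Ω E : Type*} [Fintype Ω] (P : Ω → ℝ) (f : Ω → E) (ω : Ω) : ℝ :=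
  ∑ ω', if f ω' = f ω then P ω' else 0

/-- Binary entropy of the random variable `f` on a finite space with weights `P`. -/
noncomputable def ent {Ω E : Type*} [Fintype Ω] (P : Ω → ℝ) (f : Ω → E) : ℝ :=
  -∑ ω, P ω * Real.logb 2 (mass P f ω)

/-! ### Shannon inequalities on a finite space with positive weights -/

section Entropy

variable {Ω E F G : Type*} [Fintype Ω] {P : Ω → ℝ}

theorem mass_eq_sum [DecidableEq E] (f : Ω → E) (ω : Ω) :
    mass P f ω = ∑ ω', if f ω' = f ω then P ω' else 0 := by
  unfold mass
  congr!

theorem mass_pos (hP : ∀ ω, 0 < P ω) (f : Ω → E) (ω : Ω) : 0 < mass P f ω := by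
  classical
  unfold mass
  refine Finset.sum_pos' (fun i _ => by split_ifs <;> [exact (hP i).le; exact le_rfl])
    ⟨ω, Finset.mem_univ _, by simpa using hP ω⟩

theorem mass_le_one (hP : ∀ ω, 0 < P ω) (h1 : ∑ ω, P ω = 1) (f : Ω → E) (ω : Ω) :
    mass P f ω ≤ 1 := by
  classical
  rw [← h1]
  exact Finset.sum_le_sum fun i _ => by split_ifs <;> [exact le_rfl; exact (hP i).le]

theorem le_mass (hP : ∀ ω, 0 < P ω) (f : Ω → E) (ω : Ω) : P ω ≤ mass P f ω := by
  classical
  have := Finset.single_le_sum (f := fun ω' => if f ω' = f ω then P ω' else 0)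
    (fun i _ => by split_ifs <;> [exact (hP i).le; exact le_rfl]) (Finset.mem_univ ω)
  simpa [mass] using this

theorem mass_congr {f : Ω → E} {ω ω' : Ω} (h : f ω = f ω') : mass P f ω = mass P f ω' := by
  classical
  simp only [mass_eq_sum, h]

theorem mass_congr_fun {f : Ω → E} {g : Ω → F} {ω : Ω} (h : ∀ ω', f ω' = f ω ↔ g ω' = g ω) :
    mass P f ω = mass P g ω := by
  classical
  simp only [mass_eq_sum, h]

theorem mass_mono (hP : ∀ ω, 0 < P ω) {f : Ω → E} {g : Ω → F} {ω : Ω}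
    (h : ∀ ω', f ω' = f ω → g ω' = g ω) : mass P f ω ≤ mass P g ω := by
  classical
  refine Finset.sum_le_sum fun i _ => ?_
  by_cases h1 : f i = f ω
  · simp [h1, h i h1]
  · rw [if_neg h1]; split_ifs <;> [exact (hP i).le; exact le_rfl]

/-- Entropy only depends on the partition into the fibres. -/
theorem ent_congr {f : Ω → E} {g : Ω → F} (h : ∀ ω ω', f ω = f ω' ↔ g ω = g ω') :
    ent P f = ent P g := by
  unfold ent
  congr 1
  refine Finset.sum_congr rfl fun ω _ => ?_
  rw [mass_congr_fun fun ω' => h ω' ω]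

theorem ent_mono (hP : ∀ ω, 0 < P ω) {f : Ω → E} {g : Ω → F} (h : ∀ ω ω', f ω = f ω' → g ω = g ω') :
    ent P g ≤ ent P f := by
  unfold ent
  refine neg_le_neg (Finset.sum_le_sum fun ω _ => ?_)
  refine mul_le_mul_of_nonneg_left ?_ (hP ω).le
  exact Real.logb_le_logb_of_le one_lt_two (mass_pos hP _ _) (mass_mono hP fun ω' => h ω' ω)

/-- Averaging a function of `f` against `P / P(f)` is summing over the values of `f`. -/
theorem sum_div_mass [DecidableEq E] (hP : ∀ ω, 0 < P ω) (f : Ω → E) (g : E → ℝ) :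
    ∑ ω, P ω / mass P f ω * g (f ω) = ∑ x ∈ Finset.univ.image f, g x := by
  rw [← Finset.sum_fiberwise_of_maps_to (s := Finset.univ) (t := Finset.univ.image f) (g := f)
    (fun i _ => Finset.mem_image_of_mem _ (Finset.mem_univ _))]
  refine Finset.sum_congr rfl fun x hx => ?_
  obtain ⟨ω₀, -, rfl⟩ := Finset.mem_image.1 hx
  have h : ∀ ω ∈ Finset.univ.filter (fun ω => f ω = f ω₀),
      P ω / mass P f ω * g (f ω) = P ω * (g (f ω₀) / mass P f ω₀) := by
    intro ω hω
    have hω := (Finset.mem_filter.1 hω).2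
    rw [mass_congr hω, hω]; ring
  rw [Finset.sum_congr rfl h, ← Finset.sum_mul, Finset.sum_filter, ← mass_eq_sum]
  have := (mass_pos hP f ω₀).ne'
  field_simp

/-- Jensen's inequality for the logarithm, from log x ≤ x - 1. The entropy bounds below that are not
mere monotonicity come from it through a suitable ratio `R` of probabilities. -/
theorem sum_logb_nonpos (hP : ∀ ω, 0 < P ω) (h1 : ∑ ω, P ω = 1) {R : Ω → ℝ}
    (hR : ∀ ω, 0 < R ω) (h : ∑ ω, P ω * R ω ≤ 1) : ∑ ω, P ω * Real.logb 2 (R ω) ≤ 0 := by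
  have h2 : ∑ ω, P ω * Real.log (R ω) ≤ 0 := by
    calc ∑ ω, P ω * Real.log (R ω) ≤ ∑ ω, P ω * (R ω - 1) :=
          Finset.sum_le_sum fun ω _ =>
            mul_le_mul_of_nonneg_left (Real.log_le_sub_one_of_pos (hR ω)) (hP ω).le
      _ = ∑ ω, P ω * R ω - 1 := by simp [mul_sub, h1]
      _ ≤ 0 := by linarith
  have h3 : ∑ ω, P ω * Real.logb 2 (R ω) = (∑ ω, P ω * Real.log (R ω)) / Real.log 2 := by
    rw [Finset.sum_div]; exact Finset.sum_congr rfl fun ω _ => by rw [Real.logb]; ring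
  rw [h3]
  exact div_nonpos_of_nonpos_of_nonneg h2 (Real.log_nonneg one_le_two)

/-- Submodularity of entropy. -/
theorem ent_submod (hP : ∀ ω, 0 < P ω) (h1 : ∑ ω, P ω = 1) (A : Ω → E) (B : Ω → F) (C : Ω → G) :
    ent P (fun ω => (A ω, B ω, C ω)) + ent P C ≤
      ent P (fun ω => (A ω, C ω)) + ent P (fun ω => (B ω, C ω)) := by
  classical
  set ABC : Ω → E × F × G := fun ω => (A ω, B ω, C ω)
  set AC : Ω → E × G := fun ω => (A ω, C ω)
  set BC : Ω → F × G := fun ω => (B ω, C ω)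
  have pA := mass_pos hP ABC
  have pB := mass_pos hP AC
  have pC := mass_pos hP BC
  have pD := mass_pos hP C
  have key := sum_logb_nonpos hP h1
    (R := fun ω => mass P AC ω * mass P BC ω / (mass P ABC ω * mass P C ω))
    (fun ω => by have := pA ω; have := pB ω; have := pC ω; have := pD ω; positivity) ?_
  · have h2 : ∑ ω, P ω * Real.logb 2 (mass P AC ω * mass P BC ω / (mass P ABC ω * mass P C ω)) =
        ∑ ω, P ω * Real.logb 2 (mass P AC ω) + ∑ ω, P ω * Real.logb 2 (mass P BC ω) -
        ∑ ω, P ω * Real.logb 2 (mass P ABC ω) - ∑ ω, P ω * Real.logb 2 (mass P C ω) := by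
      simp only [← Finset.sum_add_distrib, ← Finset.sum_sub_distrib]
      refine Finset.sum_congr rfl fun ω _ => ?_
      rw [Real.logb_div (mul_pos (pB ω) (pC ω)).ne' (mul_pos (pA ω) (pD ω)).ne',
        Real.logb_mul (pB ω).ne' (pC ω).ne', Real.logb_mul (pA ω).ne' (pD ω).ne']
      ring
    rw [h2] at key
    unfold ent
    linarith
  -- The product P(A,C) P(B,C) is expanded into a sum over pairs (ω₁, ω₂). For a fixed pair the sum
  -- over ω is then taken first: by `sum_div_mass` it runs over the values of (A, B, C), at most one
  -- of which is (A ω₁, B ω₂, C ω₁).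
  · have e1 : ∀ ω, P ω * (mass P AC ω * mass P BC ω / (mass P ABC ω * mass P C ω)) =
        ∑ ω₁, ∑ ω₂, P ω / mass P ABC ω *
          (if C ω₂ = C ω₁ then P ω₁ * P ω₂ / mass P C ω₁ else 0) *
            (if (A ω₁, B ω₂, C ω₁) = ABC ω then 1 else 0) := by
      intro ω
      have : P ω * (mass P AC ω * mass P BC ω / (mass P ABC ω * mass P C ω)) =
          P ω / mass P ABC ω / mass P C ω * (mass P AC ω * mass P BC ω) := by
        have := pA ω; have := pD ω; field_simp
      rw [this]
      unfold mass
      rw [Finset.sum_mul_sum, Finset.mul_sum]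
      refine Finset.sum_congr rfl fun ω₁ _ => ?_
      rw [Finset.mul_sum]
      refine Finset.sum_congr rfl fun ω₂ _ => ?_
      by_cases hA : A ω₁ = A ω <;> by_cases hB : B ω₂ = B ω <;> by_cases hC : C ω₁ = C ω <;>
        by_cases hC' : C ω₂ = C ω <;> simp [AC, BC, ABC, hA, hB, hC, hC']
      ring
    simp only [e1]
    rw [Finset.sum_comm]
    have e2 : ∀ ω₁, ∑ ω, ∑ ω₂, P ω / mass P ABC ω *
          (if C ω₂ = C ω₁ then P ω₁ * P ω₂ / mass P C ω₁ else 0) *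
            (if (A ω₁, B ω₂, C ω₁) = ABC ω then 1 else 0) ≤ P ω₁ := by
      intro ω₁
      rw [Finset.sum_comm]
      have e3 : ∀ ω₂, ∑ ω, P ω / mass P ABC ω *
          (if C ω₂ = C ω₁ then P ω₁ * P ω₂ / mass P C ω₁ else 0) *
            (if (A ω₁, B ω₂, C ω₁) = ABC ω then 1 else 0) ≤
          (if C ω₂ = C ω₁ then P ω₂ else 0) * (P ω₁ / mass P C ω₁) := by
        intro ω₂
        have e4 := sum_div_mass hP ABC (fun x => if (A ω₁, B ω₂, C ω₁) = x then (1 : ℝ) else 0)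
        have e5 : ∑ x ∈ Finset.univ.image ABC, (if (A ω₁, B ω₂, C ω₁) = x then (1 : ℝ) else 0) ≤ 1 := by
          rw [Finset.sum_ite_eq]; split_ifs <;> norm_num
        have e6 : (0 : ℝ) ≤ if C ω₂ = C ω₁ then P ω₁ * P ω₂ / mass P C ω₁ else 0 := by
          split_ifs
          · have := hP ω₁; have := hP ω₂; have := pD ω₁; positivity
          · exact le_rfl
        calc _ = (if C ω₂ = C ω₁ then P ω₁ * P ω₂ / mass P C ω₁ else 0) *
              ∑ ω, P ω / mass P ABC ω * (if (A ω₁, B ω₂, C ω₁) = ABC ω then (1 : ℝ) else 0) := by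
              rw [Finset.mul_sum]; exact Finset.sum_congr rfl fun ω _ => by ring
          _ ≤ (if C ω₂ = C ω₁ then P ω₁ * P ω₂ / mass P C ω₁ else 0) * 1 :=
              mul_le_mul_of_nonneg_left (e4 ▸ e5) e6
          _ = _ := by split_ifs <;> ring
      refine (Finset.sum_le_sum fun ω₂ _ => e3 ω₂).trans ?_
      rw [← Finset.sum_mul]
      rw [← mass_eq_sum]
      have := pD ω₁
      rw [mul_div_cancel₀ _ this.ne']
    exact (Finset.sum_le_sum fun ω₁ _ => e2 ω₁).trans h1.le

theorem ent_const (h1 : ∑ ω, P ω = 1) (e : E) : ent P (fun _ => e) = 0 := by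
  simp [ent, mass, h1]

/-- Subadditivity of entropy. -/
theorem ent_pair_le (hP : ∀ ω, 0 < P ω) (h1 : ∑ ω, P ω = 1) (A : Ω → E) (B : Ω → F) :
    ent P (fun ω => (A ω, B ω)) ≤ ent P A + ent P B := by
  have h := ent_submod hP h1 A B (fun _ => ())
  rw [ent_const h1] at h
  rw [ent_congr (g := fun ω => (A ω, B ω)) (by simp), ent_congr (g := A) (f := fun ω => (A ω, ()))
    (by simp), ent_congr (g := B) (f := fun ω => (B ω, ())) (by simp)] at h
  linarith

theorem ent_nonneg (hP : ∀ ω, 0 < P ω) (h1 : ∑ ω, P ω = 1) (A : Ω → E) : 0 ≤ ent P A := by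
  rw [← ent_const h1 ()]
  exact ent_mono hP (by simp)

theorem ent_le_logb_card (hP : ∀ ω, 0 < P ω) (h1 : ∑ ω, P ω = 1) (f : Ω → ℕ) {K : ℕ}
    (hK : 0 < K) (hf : ∀ ω, f ω < K) : ent P f ≤ Real.logb 2 K := by
  classical
  have hK' : (0 : ℝ) < K := by exact_mod_cast hK
  have pf := mass_pos hP f
  have key := sum_logb_nonpos hP h1 (R := fun ω => (K * mass P f ω)⁻¹)
    (fun ω => by have := pf ω; positivity) ?_
  · have h2 : ∑ ω, P ω * Real.logb 2 (K * mass P f ω)⁻¹ =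
        -∑ ω, P ω * Real.logb 2 (mass P f ω) - (∑ ω, P ω) * Real.logb 2 K := by
      rw [Finset.sum_mul, ← Finset.sum_neg_distrib, ← Finset.sum_sub_distrib]
      refine Finset.sum_congr rfl fun ω _ => ?_
      rw [Real.logb_inv, Real.logb_mul hK'.ne' (pf ω).ne']; ring
    rw [h2, h1] at key
    unfold ent; linarith
  · have h3 := sum_div_mass hP f (fun _ => (K : ℝ)⁻¹)
    have h4 : ∑ ω, P ω * (K * mass P f ω)⁻¹ = ∑ ω, P ω / mass P f ω * (K : ℝ)⁻¹ :=
      Finset.sum_congr rfl fun ω _ => by rw [mul_inv]; ring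
    rw [h4, h3, Finset.sum_const, nsmul_eq_mul, ← div_eq_mul_inv, div_le_one hK']
    have : (Finset.univ.image f).card ≤ (Finset.range K).card :=
      Finset.card_le_card fun x hx => by
        obtain ⟨ω, -, rfl⟩ := Finset.mem_image.1 hx
        exact Finset.mem_range.2 (hf ω)
    rw [Finset.card_range] at this
    exact_mod_cast this

end Entropy

/-! ### Entropic vectors as entropies of random variables; sums and conditioning -/

theorem entropy_eq_ent {Ω D : Type} [Fintype Ω] [Fintype D] [DecidableEq D] (P : Ω → ℝ) (g : Ω → D) :
    entropy (fun y => ∑ ω, if g ω = y then P ω else 0) = ent P g := by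
  unfold entropy ent
  congr 1
  rw [← Finset.sum_fiberwise (s := Finset.univ) (g := g)]
  refine Finset.sum_congr rfl fun y _ => ?_
  have h : ∀ ω ∈ Finset.univ.filter (fun ω => g ω = y), P ω * Real.logb 2 (mass P g ω) =
      P ω * Real.logb 2 (∑ ω, if g ω = y then P ω else 0) := by
    intro ω hω
    rw [← (Finset.mem_filter.1 hω).2]
    rw [mass_eq_sum]
  rw [Finset.sum_congr rfl h, ← Finset.sum_mul, Finset.sum_filter]

/-- The restriction of a tuple of random variables to the indices in `α`. -/
def tuple {n : ℕ} {Ω : Type} (X : Fin n → Ω → ℕ) (α : Finset (Fin n)) : Ω → α → ℕ :=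
  fun ω i => X i ω

theorem tuple_eq_iff {n : ℕ} {Ω : Type} (X : Fin n → Ω → ℕ) (α : Finset (Fin n)) (ω ω' : Ω) :
    tuple X α ω = tuple X α ω' ↔ ∀ i ∈ α, X i ω = X i ω' := by
  simp [tuple, funext_iff]

/-- `h` is the entropy vector of random variables on a finite space all of whose points have
probability at least `q`. -/
def Rep {n : ℕ} (q : ℝ) (h : SetVec n) : Prop :=
  ∃ (Ω : Type) (_ : Fintype Ω) (P : Ω → ℝ) (X : Fin n → Ω → ℕ),
    (∀ ω, q ≤ P ω) ∧ ∑ ω, P ω = 1 ∧ ∀ α, h α = ent P (tuple X α)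

theorem Rep.mem {n : ℕ} {q : ℝ} {h : SetVec n} (hq : 0 ≤ q) (hr : Rep q h) :
    h ∈ entropicRegion n := by
  classical
  obtain ⟨Ω, _, P, X, hP, h1, hh⟩ := hr
  let N : Fin n → ℕ := fun i => Finset.univ.sup (X i) + 1
  let Y : Ω → (i : Fin n) → Fin (N i) := fun ω i =>
    ⟨X i ω, Nat.lt_succ_of_le (Finset.le_sup (Finset.mem_univ ω))⟩
  refine ⟨N, fun x => ∑ ω, if Y ω = x then P ω else 0, fun x => ?_, ?_, fun α => ?_⟩
  · exact Finset.sum_nonneg fun ω _ => by split_ifs <;> [exact hq.trans (hP ω); exact le_rfl]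
  · rw [Finset.sum_comm]; simp [h1]
  · rw [hh α, ent_congr (g := fun ω (i : α) => Y ω i), ← entropy_eq_ent]
    · congr 1
      funext y
      unfold marginal
      rw [Finset.sum_comm]
      refine Finset.sum_congr rfl fun ω _ => ?_
      rw [Finset.sum_ite_eq]
      simp [funext_iff]
    · intro ω ω'
      simp [tuple, funext_iff, Y]

theorem exists_rep {n : ℕ} {h : SetVec n} (hh : h ∈ entropicRegion n) : ∃ q, 0 < q ∧ Rep q h := by
  classical
  obtain ⟨N, p, hp, h1, hα⟩ := hh
  -- Outcomes of probability zero contribute nothing to entropy. Discarding them makes the least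
  -- remaining mass a positive `q`.
  let Ω := {x : (i : Fin n) → Fin (N i) // 0 < p x}
  have hs : ∀ f : ((i : Fin n) → Fin (N i)) → ℝ, (∀ x, p x = 0 → f x = 0) →
      ∑ ω : Ω, f ω.1 = ∑ x, f x := by
    intro f hf
    rw [← Finset.sum_subtype (Finset.univ.filter fun x => 0 < p x) (by simp)]
    refine Finset.sum_subset (Finset.subset_univ _) fun x _ hx => hf x ?_
    have : ¬ 0 < p x := by simpa using hx
    exact le_antisymm (not_lt.1 this) (hp x)
  have hne : Nonempty Ω := by
    by_contra hc
    rw [not_nonempty_iff] at hc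
    have := hs p (fun _ h => h)
    rw [h1] at this
    simp at this
  obtain ⟨ω₀, -, hω₀⟩ := Finset.exists_min_image (Finset.univ : Finset Ω) (fun ω => p ω.1)
    Finset.univ_nonempty
  refine ⟨p ω₀.1, ω₀.2, Ω, inferInstance, fun ω => p ω.1, fun i ω => (ω.1 i : ℕ),
    fun ω => hω₀ ω (Finset.mem_univ _), ?_, fun α => ?_⟩
  · rw [hs p fun _ h => h, h1]
  · have e1 : marginal p α = fun y => ∑ x, if (fun i : α => x i) = y then p x else 0 := by
      funext y
      unfold marginal
      rw [Finset.sum_filter]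
      simp [funext_iff]
    rw [hα α, e1, entropy_eq_ent p (fun x (i : α) => x i)]
    unfold ent
    congr 1
    rw [← hs _ (fun x hx => by simp [hx])]
    refine Finset.sum_congr rfl fun ω _ => ?_
    congr 2
    unfold mass
    rw [← hs _ (fun x hx => by simp [hx])]
    refine Finset.sum_congr rfl fun ω' _ => ?_
    simp [tuple, funext_iff, Fin.ext_iff]

/-- The two systems are placed independently side by side: on the product space the masses multiply,
so their logarithms add. -/
theorem Rep.add {n : ℕ} {q₁ q₂ : ℝ} {h₁ h₂ : SetVec n} (p₁ : 0 < q₁) (p₂ : 0 < q₂)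
    (r₁ : Rep q₁ h₁) (r₂ : Rep q₂ h₂) : Rep (q₁ * q₂) (h₁ + h₂) := by
  classical
  obtain ⟨Ω₁, _, P₁, X₁, hP₁, hs₁, hh₁⟩ := r₁
  obtain ⟨Ω₂, _, P₂, X₂, hP₂, hs₂, hh₂⟩ := r₂
  refine ⟨Ω₁ × Ω₂, inferInstance, fun ω => P₁ ω.1 * P₂ ω.2,
    fun i ω => Nat.pair (X₁ i ω.1) (X₂ i ω.2), fun ω => ?_, ?_, fun α => ?_⟩
  · exact mul_le_mul (hP₁ _) (hP₂ _) p₂.le (p₁.le.trans (hP₁ _))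
  · rw [Fintype.sum_prod_type, ← Finset.sum_mul_sum, hs₁, hs₂, one_mul]
  · have hm : ∀ ω : Ω₁ × Ω₂, mass (fun ω : Ω₁ × Ω₂ => P₁ ω.1 * P₂ ω.2)
        (tuple (fun i (ω : Ω₁ × Ω₂) => Nat.pair (X₁ i ω.1) (X₂ i ω.2)) α) ω =
        mass P₁ (tuple X₁ α) ω.1 * mass P₂ (tuple X₂ α) ω.2 := by
      intro ω
      unfold mass
      rw [Finset.sum_mul_sum, Fintype.sum_prod_type]
      refine Finset.sum_congr rfl fun a _ => Finset.sum_congr rfl fun b _ => ?_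
      simp only [tuple_eq_iff, Nat.pair_eq_pair]
      by_cases ha : ∀ i ∈ α, X₁ i a = X₁ i ω.1
      · by_cases hb : ∀ i ∈ α, X₂ i b = X₂ i ω.2
        · rw [if_pos ha, if_pos hb, if_pos fun i hi => ⟨ha i hi, hb i hi⟩]
        · rw [if_pos ha, if_neg hb, if_neg fun h => hb fun i hi => (h i hi).2, mul_zero]
      · rw [if_neg ha, if_neg fun h => ha fun i hi => (h i hi).1, zero_mul]
    have q1 := mass_pos (fun ω => p₁.trans_le (hP₁ ω)) (tuple X₁ α)
    have q2 := mass_pos (fun ω => p₂.trans_le (hP₂ ω)) (tuple X₂ α)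
    rw [Pi.add_apply, hh₁, hh₂]
    unfold ent
    rw [← neg_add]
    congr 1
    simp only [hm]
    have e : ∀ ω : Ω₁ × Ω₂, P₁ ω.1 * P₂ ω.2 *
        Real.logb 2 (mass P₁ (tuple X₁ α) ω.1 * mass P₂ (tuple X₂ α) ω.2) =
        (P₁ ω.1 * Real.logb 2 (mass P₁ (tuple X₁ α) ω.1)) * P₂ ω.2 +
        P₁ ω.1 * (P₂ ω.2 * Real.logb 2 (mass P₂ (tuple X₂ α) ω.2)) := fun ω => by
      rw [Real.logb_mul (q1 _).ne' (q2 _).ne']; ring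
    simp only [e, Finset.sum_add_distrib, Fintype.sum_prod_type]
    rw [← Finset.sum_mul_sum, ← Finset.sum_mul_sum, hs₁, hs₂, one_mul, mul_one]

theorem Rep.zero {n : ℕ} : Rep 1 (0 : SetVec n) :=
  ⟨Unit, inferInstance, fun _ => 1, fun _ _ => 0, fun _ => le_rfl, by simp, fun α => by
    simp [ent, mass]⟩

/-- The lower bound on the masses is carried along for N copies: -log₂ of a conditional probability
is then at most N times -log₂ q, so its integer part takes only O(N) values. -/
theorem Rep.nsmul {n : ℕ} {q : ℝ} {h : SetVec n} (hq : 0 < q) (r : Rep q h) (N : ℕ) :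
    Rep (q ^ N) (N • h) := by
  induction N with
  | zero => simpa using Rep.zero
  | succ N ih => rw [pow_succ, succ_nsmul]; exact ih.add (pow_pos hq N) hq r

theorem add_mem_entropicRegion {n : ℕ} {h₁ h₂ : SetVec n} (m₁ : h₁ ∈ entropicRegion n)
    (m₂ : h₂ ∈ entropicRegion n) : h₁ + h₂ ∈ entropicRegion n := by
  obtain ⟨q₁, p₁, r₁⟩ := exists_rep m₁
  obtain ⟨q₂, p₂, r₂⟩ := exists_rep m₂
  exact (r₁.add p₁ p₂ r₂).mem (mul_pos p₁ p₂).le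

theorem zero_mem_entropicRegion {n : ℕ} : (0 : SetVec n) ∈ entropicRegion n :=
  Rep.zero.mem zero_le_one

theorem nsmul_mem_entropicRegion {n : ℕ} {h : SetVec n} (m : h ∈ entropicRegion n) (N : ℕ) :
    N • h ∈ entropicRegion n := by
  induction N with
  | zero => simpa using zero_mem_entropicRegion
  | succ N ih => rw [succ_nsmul]; exact add_mem_entropicRegion ih m

theorem basicModular_mem_entropicRegion {n : ℕ} (j : Fin n) :
    (basicModular j : SetVec n) ∈ entropicRegion n := by
  classical
  -- The `j`-th variable is a fair bit and all others are constant.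
  refine Rep.mem (q := 1 / 2) (by norm_num) ⟨Bool, inferInstance, fun _ => 1 / 2,
    fun i b => if i = j then b.toNat else 0, fun _ => le_rfl, by simp, fun α => ?_⟩
  unfold basicModular
  by_cases hj : j ∈ α
  · rw [ent_congr (g := id), if_pos hj]
    · simp [ent, mass]
    · intro a b
      rw [tuple_eq_iff]
      constructor
      · intro h
        have := h j hj
        revert this
        cases a <;> cases b <;> simp
      · rintro h i -
        rw [show a = b from h]
  · rw [ent_congr (g := fun _ => ()), ent_const (by simp), if_neg hj]
    intro a b
    rw [tuple_eq_iff]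
    simp only [iff_true]
    intro i hi
    have : i ≠ j := fun h => hj (h ▸ hi)
    simp [this]

/-- A valid inequality holds for the conditional entropies given any random variable `V`. -/
theorem Valid.cond {n : ℕ} {c : SetVec n} (hc : Valid (entropicRegion n) c) {Ω F : Type} [Fintype Ω]
    {P : Ω → ℝ} (hP : ∀ ω, 0 < P ω) (X : Fin n → Ω → ℕ) (V : Ω → F) :
    0 ≤ ∑ α, c α * (ent P (fun ω => (tuple X α ω, V ω)) - ent P V) := by
  classical
  let m : F → ℝ := fun v => ∑ ω, if V ω = v then P ω else 0
  let Q : (v : F) → {ω // V ω = v} → ℝ := fun v ω => P ω.1 / m v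
  have hsub : ∀ (v : F) (f : Ω → ℝ), ∑ ω : {ω // V ω = v}, f ω.1 = ∑ ω, if V ω = v then f ω else 0 := by
    intro v f
    rw [← Finset.sum_filter]
    exact (Finset.sum_subtype (Finset.univ.filter fun ω => V ω = v) (by simp) f).symm
  have hm : ∀ ω, m (V ω) = mass P V ω := fun ω => rfl
  -- Chain rule: the conditional entropy is the average, over the values v of V, of the entropy
  -- under the conditional law `Q v`. Each of these laws gives an entropic vector, to which the
  -- inequality applies.
  have key : ∀ α, ent P (fun ω => (tuple X α ω, V ω)) - ent P V =
      ∑ v ∈ Finset.univ.image V, m v *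
        ent (Q v) (tuple (fun i (ω : {ω // V ω = v}) => X i ω.1) α) := by
    intro α
    have pf := mass_pos hP (fun ω => (tuple X α ω, V ω))
    have pV := mass_pos hP V
    have e1 : ent P (fun ω => (tuple X α ω, V ω)) - ent P V = ∑ ω, -(P ω *
        Real.logb 2 (mass P (fun ω => (tuple X α ω, V ω)) ω / mass P V ω)) := by
      unfold ent
      rw [← neg_add', ← sub_eq_add_neg, ← Finset.sum_sub_distrib, ← Finset.sum_neg_distrib]
      refine Finset.sum_congr rfl fun ω _ => ?_
      rw [Real.logb_div (pf ω).ne' (pV ω).ne']; ring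
    rw [e1, ← Finset.sum_fiberwise_of_maps_to (s := Finset.univ) (t := Finset.univ.image V) (g := V)
      (fun i _ => Finset.mem_image_of_mem _ (Finset.mem_univ _))]
    refine Finset.sum_congr rfl fun v hv => ?_
    obtain ⟨ω₀, -, rfl⟩ := Finset.mem_image.1 hv
    have hm0 : 0 < m (V ω₀) := pV ω₀
    unfold ent
    rw [Finset.sum_neg_distrib, mul_neg, Finset.sum_filter, ← hsub, Finset.mul_sum]
    congr 1
    refine Finset.sum_congr rfl fun ω _ => ?_
    have e2 : mass (Q (V ω₀)) (tuple (fun i (ω : {ω // V ω = V ω₀}) => X i ω.1) α) ω =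
        mass P (fun ω => (tuple X α ω, V ω)) ω.1 / mass P V ω.1 := by
      rw [mass_congr ω.2]
      unfold mass
      rw [Finset.sum_div]
      have := hsub (V ω₀) (fun ω' => (if tuple X α ω' = tuple X α ω.1 then P ω' else 0) / m (V ω₀))
      calc _ = ∑ ω' : {ω // V ω = V ω₀},
            (if tuple X α ω'.1 = tuple X α ω.1 then P ω'.1 else 0) / m (V ω₀) :=
            Finset.sum_congr rfl fun ω' _ => by
              have : tuple (fun i (ω : {ω // V ω = V ω₀}) => X i ω.1) α ω' =
                tuple (fun i (ω : {ω // V ω = V ω₀}) => X i ω.1) α ω ↔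
                tuple X α ω'.1 = tuple X α ω.1 := by simp [tuple_eq_iff]
              simp only [this, Q]
              split_ifs <;> simp
        _ = _ := this
        _ = _ := Finset.sum_congr rfl fun ω' _ => by
              simp only [Prod.mk.injEq, ω.2]
              by_cases h1 : tuple X α ω' = tuple X α ω.1 <;> by_cases h2 : V ω' = V ω₀ <;>
                simp [h1, h2, m]
    rw [e2]
    simp only [Q]
    field_simp
  simp only [key, Finset.mul_sum]
  rw [Finset.sum_comm]
  refine Finset.sum_nonneg fun v hv => ?_
  obtain ⟨ω₀, -, rfl⟩ := Finset.mem_image.1 hv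
  have hm0 : 0 < m (V ω₀) := mass_pos hP V ω₀
  have hmem : (fun α => ent (Q (V ω₀)) (tuple (fun i (ω : {ω // V ω = V ω₀}) => X i ω.1) α)) ∈
      entropicRegion n := by
    refine Rep.mem le_rfl ⟨_, inferInstance, Q (V ω₀), _, fun ω => div_nonneg (hP _).le hm0.le, ?_,
      fun α => rfl⟩
    have := hsub (V ω₀) (fun ω => P ω / m (V ω₀))
    rw [show ∑ ω, Q (V ω₀) ω = ∑ ω : {ω // V ω = V ω₀}, P ω.1 / m (V ω₀) from rfl, this]
    rw [← div_self hm0.ne', Finset.sum_div]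
    exact Finset.sum_congr rfl fun ω _ => by split_ifs <;> simp
  have := hc _ hmem
  unfold dot at this
  have e : ∑ α, c α * (m (V ω₀) * ent (Q (V ω₀))
      (tuple (fun i (ω : {ω // V ω = V ω₀}) => X i ω.1) α)) =
      m (V ω₀) * ∑ α, c α * ent (Q (V ω₀))
      (tuple (fun i (ω : {ω // V ω = V ω₀}) => X i ω.1) α) := by
    rw [Finset.mul_sum]; exact Finset.sum_congr rfl fun α _ => by ring
  rw [e]
  exact mul_nonneg hm0.le this

/-! ### Randomness extraction by hashing -/

section Hash

variable {Ω E F : Type} [Fintype Ω] {P : Ω → ℝ}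

/-- Shifting the value of `f j` at `x` by `s` permutes the functions and turns the collision into
the event `f j x' - f j x = s`. These 2^j events partition the family, so each has probability
2^(-j). -/
theorem sum_collision {E : Type} [Fintype E] [DecidableEq E] {K : ℕ} (j : Fin K) {x x' : E}
    (hx : x ≠ x') :
    2 ^ (j : ℕ) * ∑ f : (j : Fin K) → E → Fin (2 ^ (j : ℕ)), (if f j x = f j x' then (1 : ℝ) else 0) =
      Fintype.card ((j : Fin K) → E → Fin (2 ^ (j : ℕ))) := by
  have h1 : ∀ s : Fin (2 ^ (j : ℕ)),
      ∑ f : (j : Fin K) → E → Fin (2 ^ (j : ℕ)), (if f j x = f j x' then (1 : ℝ) else 0) =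
      ∑ f : (j : Fin K) → E → Fin (2 ^ (j : ℕ)), (if s = f j x' - f j x then (1 : ℝ) else 0) := by
    intro s
    rw [← Equiv.sum_comp (Equiv.addRight (Pi.single j (Pi.single x s)))]
    refine Finset.sum_congr rfl fun f _ => ?_
    simp [hx.symm, eq_sub_iff_add_eq, add_comm]
  have h2 : ∑ _s : Fin (2 ^ (j : ℕ)),
      ∑ f : (j : Fin K) → E → Fin (2 ^ (j : ℕ)), (if f j x = f j x' then (1 : ℝ) else 0) =
      Fintype.card ((j : Fin K) → E → Fin (2 ^ (j : ℕ))) := by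
    rw [Finset.sum_congr rfl fun s _ => h1 s, Finset.sum_comm]
    simp only [Finset.sum_ite_eq', Finset.mem_univ, if_true]
    simp
  rw [← h2]
  simp

/-- A leftover hash lemma: if `X` has conditional min-entropy at least `J` given `Y`, then `J` bits
can be extracted from `X` that are nearly uniform given `Y`. -/
theorem exists_hash [Fintype E] (hP : ∀ ω, 0 < P ω) (h1 : ∑ ω, P ω = 1) (X : Ω → E) (Y : Ω → F)
    (J : Ω → ℕ) (hJ : ∀ ω, 2 ^ J ω * mass P (fun ω => (X ω, Y ω)) ω ≤ mass P Y ω) :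
    ∃ M : Ω → ℕ, (∀ ω, M ω < 2 ^ J ω) ∧ (∀ ω ω', J ω = J ω' → X ω = X ω' → M ω = M ω') ∧
      ∑ ω, P ω * J ω - 1 ≤ ent P (fun ω => ((M ω, J ω), Y ω)) - ent P Y := by
  classical
  obtain ⟨K, hK⟩ : ∃ K, ∀ ω, J ω < K :=
    ⟨Finset.univ.sup J + 1, fun ω => Nat.lt_succ_of_le (Finset.le_sup (Finset.mem_univ ω))⟩
  let 𝓕 := (j : Fin K) → E → Fin (2 ^ (j : ℕ))
  let M : 𝓕 → Ω → ℕ := fun f ω => (f ⟨J ω, hK ω⟩ (X ω)).val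
  have hMf : ∀ f ω j (h : J ω = j) (hj : j < K), M f ω = (f ⟨j, hj⟩ (X ω)).val := by
    rintro f ω j rfl hj; rfl
  have pY := mass_pos hP Y
  have pM := fun f : 𝓕 => mass_pos hP (fun ω => ((M f ω, J ω), Y ω))
  -- The mean of log₂ R is E J - 1 - H(M, J | Y), so by Jensen it suffices to find `f` with E R ≤ 1.
  -- For each ω the average over `f` is at most 1: two points with the same Y collide either through
  -- equal X or with probability at most 2^(-J), and the hypothesis on `J` bounds both contributions
  -- by P(Y) / 2^J. The factor 2 for the two contributions is the lost bit.
  let R : 𝓕 → Ω → ℝ := fun f ω => 2 ^ J ω / (2 * mass P Y ω) * mass P (fun ω => ((M f ω, J ω), Y ω)) ω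
  have hcard : (0 : ℝ) < Fintype.card 𝓕 := by
    have : 0 < Fintype.card 𝓕 := Fintype.card_pos
    exact_mod_cast this
  have coll : ∀ ω ω', ∑ f : 𝓕, (if ((M f ω', J ω'), Y ω') = ((M f ω, J ω), Y ω) then P ω' else 0) ≤
      Fintype.card 𝓕 * ((if (X ω', Y ω') = (X ω, Y ω) then P ω' else 0) +
        (if Y ω' = Y ω then P ω' else 0) / 2 ^ J ω) := by
    intro ω ω'
    have hω' := (hP ω').le
    by_cases hY : Y ω' = Y ω
    swap
    · simp [hY]
    by_cases hX : X ω' = X ω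
    · simp only [hY, hX, if_true]
      calc _ ≤ ∑ f : 𝓕, P ω' := Finset.sum_le_sum fun f _ => by split_ifs <;> simp [hω']
        _ = Fintype.card 𝓕 * P ω' := by simp
        _ ≤ _ := mul_le_mul_of_nonneg_left (le_add_of_nonneg_right (by positivity)) hcard.le
    · have h0 : (if (X ω', Y ω') = (X ω, Y ω) then P ω' else 0) = 0 := by simp [hX]
      rw [h0, if_pos hY, zero_add]
      have h2 := sum_collision (⟨J ω, hK ω⟩ : Fin K) (x := X ω') (x' := X ω) hX
      calc _ ≤ ∑ f : 𝓕, P ω' * (if f ⟨J ω, hK ω⟩ (X ω') = f ⟨J ω, hK ω⟩ (X ω) then (1 : ℝ) else 0) := by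
            refine Finset.sum_le_sum fun f _ => ?_
            by_cases hc : ((M f ω', J ω'), Y ω') = ((M f ω, J ω), Y ω)
            · rw [if_pos hc]
              simp only [Prod.mk.injEq] at hc
              have : f ⟨J ω, hK ω⟩ (X ω') = f ⟨J ω, hK ω⟩ (X ω) :=
                Fin.ext (hMf f ω' _ hc.1.2 (hK ω) ▸ hc.1.1)
              rw [if_pos this, mul_one]
            · rw [if_neg hc]; split_ifs <;> simp [hω']
        _ = _ := by
            rw [← Finset.mul_sum, ← h2]
            field_simp
            congr!
  have avg : ∀ ω, ∑ f, R f ω ≤ Fintype.card 𝓕 := by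
    intro ω
    have h2 : ∑ f : 𝓕, mass P (fun ω => ((M f ω, J ω), Y ω)) ω ≤
        Fintype.card 𝓕 * (mass P (fun ω => (X ω, Y ω)) ω + mass P Y ω / 2 ^ J ω) := by
      simp only [mass_eq_sum]
      rw [Finset.sum_comm, Finset.sum_div, ← Finset.sum_add_distrib, Finset.mul_sum]
      exact Finset.sum_le_sum fun ω' _ => coll ω ω'
    have h3 : mass P (fun ω => (X ω, Y ω)) ω + mass P Y ω / 2 ^ J ω ≤ 2 * mass P Y ω / 2 ^ J ω := by
      have : mass P (fun ω => (X ω, Y ω)) ω ≤ mass P Y ω / 2 ^ J ω := by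
        rw [le_div_iff₀ (by positivity), mul_comm]; exact hJ ω
      rw [mul_div_assoc]; linarith
    simp only [R]
    rw [← Finset.mul_sum]
    have := pY ω
    calc _ ≤ 2 ^ J ω / (2 * mass P Y ω) * (Fintype.card 𝓕 * (2 * mass P Y ω / 2 ^ J ω)) := by
          refine mul_le_mul_of_nonneg_left (h2.trans ?_) (by positivity)
          exact mul_le_mul_of_nonneg_left h3 hcard.le
      _ = _ := by field_simp
  obtain ⟨f, -, hf⟩ : ∃ f ∈ (Finset.univ : Finset 𝓕), ∑ ω, P ω * R f ω ≤ 1 := by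
    refine Finset.exists_le_of_sum_le Finset.univ_nonempty ?_
    rw [Finset.sum_comm]
    calc _ ≤ ∑ ω, P ω * Fintype.card 𝓕 := Finset.sum_le_sum fun ω _ => by
          rw [← Finset.mul_sum]; exact mul_le_mul_of_nonneg_left (avg ω) (hP ω).le
      _ = _ := by rw [← Finset.sum_mul, h1]; simp
  refine ⟨M f, fun ω => Fin.isLt _, fun ω ω' hj hx => ?_, ?_⟩
  · rw [hMf f ω _ hj (hK ω'), hx]
  · have key := sum_logb_nonpos hP h1 (R := R f)
      (fun ω => by have := pM f ω; have := pY ω; positivity) hf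
    have h2 : ∑ ω, P ω * Real.logb 2 (R f ω) = ∑ ω, P ω * J ω - ∑ ω, P ω -
        ∑ ω, P ω * Real.logb 2 (mass P Y ω) +
        ∑ ω, P ω * Real.logb 2 (mass P (fun ω => ((M f ω, J ω), Y ω)) ω) := by
      simp only [← Finset.sum_add_distrib, ← Finset.sum_sub_distrib]
      refine Finset.sum_congr rfl fun ω _ => ?_
      have := pY ω
      have := pM f ω
      rw [Real.logb_mul (by positivity) (by positivity), Real.logb_div (by positivity) (by positivity),
        Real.logb_mul (by positivity) (by positivity), Real.logb_pow,
        Real.logb_self_eq_one one_lt_two]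
      ring
    rw [h2, h1] at key
    unfold ent
    linarith

/-- Given J = j there are at most 2^j values of M, so H(M | J) is at most the mean of J. -/
theorem ent_pair_sub_le (hP : ∀ ω, 0 < P ω) (h1 : ∑ ω, P ω = 1) (M J : Ω → ℕ)
    (hM : ∀ ω, M ω < 2 ^ J ω) : ent P (fun ω => (M ω, J ω)) - ent P J ≤ ∑ ω, P ω * J ω := by
  classical
  have pJ := mass_pos hP J
  have pM := mass_pos hP (fun ω => (M ω, J ω))
  let R : Ω → ℝ := fun ω => mass P J ω / (mass P (fun ω => (M ω, J ω)) ω * 2 ^ J ω)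
  have hR : ∑ ω, P ω * R ω ≤ 1 := by
    have e1 : ∀ ω, P ω * R ω = ∑ ω', P ω / mass P (fun ω => (M ω, J ω)) ω *
        ((if J ω' = J ω then P ω' else 0) / 2 ^ J ω) := by
      intro ω
      rw [← Finset.mul_sum, ← Finset.sum_div, ← mass_eq_sum]
      have := pM ω
      simp only [R]
      field_simp
    simp only [e1]
    rw [Finset.sum_comm]
    calc _ ≤ ∑ ω, P ω := ?_
      _ ≤ 1 := h1.le
    refine Finset.sum_le_sum fun ω' _ => ?_
    rw [sum_div_mass hP (fun ω => (M ω, J ω)) (fun x => (if J ω' = x.2 then P ω' else 0) / 2 ^ x.2)]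
    have hsub : ∑ x ∈ Finset.univ.image (fun ω => (M ω, J ω)),
        (if J ω' = x.2 then P ω' else 0) / 2 ^ x.2 ≤
        ∑ x ∈ (Finset.range (2 ^ J ω')).image (fun m => (m, J ω')), P ω' / 2 ^ J ω' := by
      have : ∑ x ∈ Finset.univ.image (fun ω => (M ω, J ω)),
        (if J ω' = x.2 then P ω' else 0) / 2 ^ x.2 =
        ∑ x ∈ (Finset.univ.image (fun ω => (M ω, J ω))).filter (fun x => J ω' = x.2),
          P ω' / 2 ^ J ω' := by
        rw [Finset.sum_filter]
        exact Finset.sum_congr rfl fun x _ => by split_ifs with h <;> simp [h]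
      rw [this]
      refine Finset.sum_le_sum_of_subset_of_nonneg ?_
        (fun _ _ _ => div_nonneg (hP _).le (by positivity))
      intro x hx
      obtain ⟨hx1, hx2⟩ := Finset.mem_filter.1 hx
      obtain ⟨ω, -, rfl⟩ := Finset.mem_image.1 hx1
      refine Finset.mem_image.2 ⟨M ω, Finset.mem_range.2 ?_, ?_⟩
      · dsimp only at hx2
        rw [hx2]; exact hM ω
      · dsimp only at hx2
        rw [hx2]
    refine hsub.trans ?_
    rw [Finset.sum_const, nsmul_eq_mul, Finset.card_image_of_injective _ (fun a b h => by simpa using h),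
      Finset.card_range]
    push_cast
    rw [mul_div_cancel₀ _ (by positivity)]
  have key := sum_logb_nonpos hP h1 (R := R)
    (fun ω => by have := pM ω; have := pJ ω; positivity) hR
  have h2 : ∑ ω, P ω * Real.logb 2 (R ω) = ∑ ω, P ω * Real.logb 2 (mass P J ω) -
      ∑ ω, P ω * Real.logb 2 (mass P (fun ω => (M ω, J ω)) ω) - ∑ ω, P ω * J ω := by
    simp only [← Finset.sum_sub_distrib]
    refine Finset.sum_congr rfl fun ω _ => ?_
    have := pJ ω
    have := pM ω
    rw [Real.logb_div (by positivity) (by positivity), Real.logb_mul (by positivity) (by positivity),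
      Real.logb_pow, Real.logb_self_eq_one one_lt_two]
    ring
  rw [h2] at key
  unfold ent
  linarith

end Hash

/-! ### Removing private information from a valid inequality -/

/-- There is a random variable given which the entropies are, up to a small error, those of
the same variables with the private information of the `i`-th variable removed. -/
theorem exists_cond {n : ℕ} {Ω : Type} [Fintype Ω] {P : Ω → ℝ} {q : ℝ} (hq : 0 < q)
    (hqP : ∀ ω, q ≤ P ω) (h1 : ∑ ω, P ω = 1) (X : Fin n → Ω → ℕ) (i : Fin n) :
    ∃ V : Ω → ℕ × ℕ, ∀ α, |ent P (fun ω => (tuple X α ω, V ω)) - ent P V - (ent P (tuple X α) -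
      if i ∈ α then ent P (tuple X Finset.univ) - ent P (tuple X (Finset.univ.erase i)) else 0)| ≤
      Real.logb 2 ((⌊-Real.logb 2 q⌋₊ + 1 : ℕ) : ℝ) + 2 := by
  classical
  have hP : ∀ ω, 0 < P ω := fun ω => hq.trans_le (hqP ω)
  let Y := tuple X (Finset.univ.erase i)
  let Xi : Ω → Fin (Finset.univ.sup (X i) + 1) := fun ω =>
    ⟨X i ω, Nat.lt_succ_of_le (Finset.le_sup (Finset.mem_univ ω))⟩
  have hXi : ∀ ω ω', Xi ω = Xi ω' ↔ X i ω = X i ω' := fun ω ω' => by simp [Xi]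
  have hXY : ∀ ω ω', (Xi ω, Y ω) = (Xi ω', Y ω') ↔
      tuple X Finset.univ ω = tuple X Finset.univ ω' := by
    intro ω ω'
    rw [Prod.mk.injEq, hXi, tuple_eq_iff, tuple_eq_iff]
    constructor
    · rintro ⟨h, h'⟩ j -
      by_cases hj : j = i
      · exact hj ▸ h
      · exact h' j (by simp [hj])
    · exact fun h => ⟨h i (Finset.mem_univ _), fun j _ => h j (Finset.mem_univ _)⟩
  have pY := mass_pos hP Y
  have pXY := mass_pos hP (fun ω => (Xi ω, Y ω))
  let ρ : Ω → ℝ := fun ω => mass P (fun ω => (Xi ω, Y ω)) ω / mass P Y ω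
  have pρ : ∀ ω, 0 < ρ ω := fun ω => div_pos (pXY ω) (pY ω)
  have ρ1 : ∀ ω, ρ ω ≤ 1 := fun ω => by
    rw [div_le_one (pY ω)]
    exact mass_mono hP fun ω' h => (Prod.mk.inj h).2
  have ρq : ∀ ω, q ≤ ρ ω := fun ω => by
    rw [le_div_iff₀ (pY ω)]
    have a := mass_le_one hP h1 Y ω
    have b := le_mass hP (fun ω => (Xi ω, Y ω)) ω
    have c := hqP ω
    nlinarith
  -- The number of extracted bits varies with the outcome: it is the rounded-down surprisal of the
  -- `i`-th variable given the others. The min-entropy hypothesis of `exists_hash` thus holds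
  -- pointwise, without any typicality argument, and the mean of J is within 1 of h(i | rest).
  let J : Ω → ℕ := fun ω => ⌊-Real.logb 2 (ρ ω)⌋₊
  have hl : ∀ ω, 0 ≤ -Real.logb 2 (ρ ω) := fun ω =>
    neg_nonneg.2 (Real.logb_nonpos one_lt_two (pρ ω).le (ρ1 ω))
  have J1 : ∀ ω, (J ω : ℝ) ≤ -Real.logb 2 (ρ ω) := fun ω => Nat.floor_le (hl ω)
  have J2 : ∀ ω, -Real.logb 2 (ρ ω) - 1 ≤ J ω := fun ω => by
    have := Nat.lt_floor_add_one (-Real.logb 2 (ρ ω))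
    simp only [J]; linarith
  -- Few values of J, hence H(J) ≤ ℓ: revealing J costs only a logarithmic error.
  have JK : ∀ ω, J ω < ⌊-Real.logb 2 q⌋₊ + 1 := fun ω => by
    refine Nat.lt_succ_of_le (Nat.floor_le_floor ?_)
    exact neg_le_neg (Real.logb_le_logb_of_le one_lt_two hq (ρq ω))
  have hD : ∑ ω, P ω * -Real.logb 2 (ρ ω) =
      ent P (tuple X Finset.univ) - ent P (tuple X (Finset.univ.erase i)) := by
    rw [← ent_congr hXY]
    unfold ent
    rw [← neg_add', ← sub_eq_add_neg, ← Finset.sum_sub_distrib, ← Finset.sum_neg_distrib]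
    refine Finset.sum_congr rfl fun ω _ => ?_
    simp only [ρ]
    rw [Real.logb_div (pXY ω).ne' (pY ω).ne']
    simp only [Y]
    ring
  set D := ent P (tuple X Finset.univ) - ent P (tuple X (Finset.univ.erase i)) with hDdef
  set EJ := ∑ ω, P ω * J ω with hEJ
  have f4 : EJ ≤ D := by
    rw [← hD]
    exact Finset.sum_le_sum fun ω _ => mul_le_mul_of_nonneg_left (J1 ω) (hP ω).le
  have f5 : D - 1 ≤ EJ := by
    rw [← hD, ← h1, ← Finset.sum_sub_distrib]
    refine Finset.sum_le_sum fun ω _ => ?_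
    have := mul_le_mul_of_nonneg_left (J2 ω) (hP ω).le
    linarith
  obtain ⟨M, hM, hMJ, f3⟩ := exists_hash hP h1 Xi Y J (fun ω => by
    have h : (2 : ℝ) ^ J ω ≤ (ρ ω)⁻¹ := by
      rw [← Real.rpow_natCast, ← Real.le_logb_iff_rpow_le one_lt_two (inv_pos.2 (pρ ω)),
        Real.logb_inv]
      exact J1 ω
    have h2 : mass P (fun ω => (Xi ω, Y ω)) ω = ρ ω * mass P Y ω := by
      simp only [ρ]; have := pY ω; field_simp
    calc _ ≤ (ρ ω)⁻¹ * (ρ ω * mass P Y ω) := by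
          rw [h2]; exact mul_le_mul_of_nonneg_right h (mul_pos (pρ ω) (pY ω)).le
      _ = _ := by have := pρ ω; field_simp)
  have f1 : ent P J ≤ Real.logb 2 ((⌊-Real.logb 2 q⌋₊ + 1 : ℕ) : ℝ) :=
    ent_le_logb_card hP h1 J (Nat.succ_pos _) JK
  have f2 := ent_pair_sub_le hP h1 M J hM
  set ℓ := Real.logb 2 ((⌊-Real.logb 2 q⌋₊ + 1 : ℕ) : ℝ)
  have J0 := ent_nonneg hP h1 J
  refine ⟨fun ω => (M ω, J ω), fun α => ?_⟩
  set V : Ω → ℕ × ℕ := fun ω => (M ω, J ω)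
  have f6 := ent_pair_le hP h1 V Y
  -- If i ∈ α, then X_α and J determine M, so H(X_α, V) is within ℓ of H(X_α) while H(V) is close to
  -- h(i | rest). If i ∉ α, then X_α is a function of Y, of which V is almost independent.
  by_cases hi : i ∈ α
  · rw [if_pos hi]
    have g1 : ent P (fun ω => (tuple X α ω, V ω)) = ent P (fun ω => (tuple X α ω, J ω)) := by
      refine ent_congr fun ω ω' => ?_
      simp only [V, Prod.mk.injEq]
      constructor
      · rintro ⟨h, -, h'⟩; exact ⟨h, h'⟩
      · rintro ⟨h, h'⟩
        exact ⟨h, hMJ ω ω' h' ((hXi _ _).2 ((tuple_eq_iff X α ω ω').1 h i hi)), h'⟩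
    have g2 := ent_pair_le hP h1 (tuple X α) J
    have g3 : ent P (tuple X α) ≤ ent P (fun ω => (tuple X α ω, J ω)) :=
      ent_mono hP fun ω ω' h => (Prod.mk.inj h).1
    rw [g1, abs_le]
    constructor <;> linarith
  · rw [if_neg hi]
    have hYα : ∀ ω ω', Y ω = Y ω' → tuple X α ω = tuple X α ω' := by
      intro ω ω' h
      rw [tuple_eq_iff] at h ⊢
      exact fun j hj => h j (by simpa using fun e : j = i => hi (e ▸ hj))
    have g1 := ent_pair_le hP h1 (tuple X α) V
    have g2 := ent_submod hP h1 Y V (tuple X α)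
    rw [ent_congr (f := fun ω => (Y ω, V ω, tuple X α ω)) (g := fun ω => (V ω, Y ω)) (fun ω ω' => by
        simp only [Prod.mk.injEq]
        exact ⟨fun ⟨a, b, _⟩ => ⟨b, a⟩, fun ⟨b, a⟩ => ⟨a, b, hYα _ _ a⟩⟩),
      ent_congr (f := fun ω => (Y ω, tuple X α ω)) (g := Y) (fun ω ω' => by
        simp only [Prod.mk.injEq]
        exact ⟨fun ⟨a, _⟩ => a, fun a => ⟨a, hYα _ _ a⟩⟩),
      ent_congr (f := fun ω => (V ω, tuple X α ω)) (g := fun ω => (tuple X α ω, V ω)) (fun ω ω' => by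
        simp only [Prod.mk.injEq]
        exact and_comm)] at g2
    rw [abs_le]
    constructor <;> linarith

/-- Validity is preserved by subtracting from an inequality the multiple of `h(i | rest)` that
makes it balanced at the variable `i`. -/
theorem Valid.sub_private {n : ℕ} {c : SetVec n} (hc : Valid (entropicRegion n) c) (i : Fin n)
    {h : SetVec n} (hh : h ∈ entropicRegion n) :
    0 ≤ dot c h - dot c (basicModular i) * (h Finset.univ - h (Finset.univ.erase i)) := by
  obtain ⟨q, hq, r⟩ := exists_rep hh
  set D := h Finset.univ - h (Finset.univ.erase i)
  set x := dot c h - dot c (basicModular i) * D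
  set C := ∑ α, |c α|
  have hC : 0 ≤ C := Finset.sum_nonneg fun _ _ => abs_nonneg _
  have q1 : q ≤ 1 := by
    obtain ⟨Ω, _, P, X, hP, h1, -⟩ := r
    have : Nonempty Ω := by
      by_contra hn
      rw [not_nonempty_iff] at hn
      simp at h1
    obtain ⟨ω⟩ := this
    calc q ≤ P ω := hP ω
      _ ≤ ∑ ω, P ω := Finset.single_le_sum (fun i _ => hq.le.trans (hP i)) (Finset.mem_univ ω)
      _ = 1 := h1
  have step : ∀ N : ℕ,
      -(C * (Real.logb 2 ((⌊-Real.logb 2 (q ^ N)⌋₊ + 1 : ℕ) : ℝ) + 2)) ≤ N * x := by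
    intro N
    obtain ⟨Ω, _, P, X, hP, h1, hX⟩ := r.nsmul hq N
    have hqN := pow_pos hq N
    obtain ⟨V, hV⟩ := exists_cond hqN hP h1 X i
    set ℓ := Real.logb 2 ((⌊-Real.logb 2 (q ^ N)⌋₊ + 1 : ℕ) : ℝ) + 2
    have h0 := hc.cond (fun ω => hqN.trans_le (hP ω)) X V
    have h2 : ∑ α, c α * (ent P (fun ω => (tuple X α ω, V ω)) - ent P V) ≤ ∑ α, (|c α| * ℓ +
        c α * (N * h α - if i ∈ α then N * D else 0)) := by
      refine Finset.sum_le_sum fun α _ => ?_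
      have h3 := hV α
      rw [← hX, ← hX, ← hX] at h3
      simp only [Pi.smul_apply, nsmul_eq_mul, ← mul_sub] at h3
      have h4 := le_abs_self (c α * (ent P (fun ω => (tuple X α ω, V ω)) - ent P V -
        (N * h α - if i ∈ α then N * D else 0)))
      rw [abs_mul] at h4
      have h5 := h4.trans (mul_le_mul_of_nonneg_left h3 (abs_nonneg (c α)))
      linarith
    have h5 : ∑ α, (|c α| * ℓ + c α * (N * h α - if i ∈ α then N * D else 0)) = C * ℓ + N * x := by
      rw [Finset.sum_add_distrib, ← Finset.sum_mul]
      congr 1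
      simp only [x, dot, mul_sub, Finset.mul_sum, Finset.sum_mul]
      rw [← Finset.sum_sub_distrib]
      refine Finset.sum_congr rfl fun α _ => ?_
      unfold basicModular
      split_ifs <;> ring
    linarith
  set a := -Real.logb 2 q with ha
  have a0 : 0 ≤ a := neg_nonneg.2 (Real.logb_nonpos one_lt_two hq.le q1)
  set b := Real.logb 2 (a + 1)
  -- Taking N = 2^m makes the logarithmic error linear in m, so that it vanishes after division by
  -- N. The exponent in `m ^ 1` fits the form of the limit theorem used below.
  have step2 : ∀ m : ℕ, -(C * (m ^ 1 / (2 : ℝ) ^ m + (b + 2) * (1 / 2) ^ m)) ≤ x := by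
    intro m
    have h1 := step (2 ^ m)
    have h2 : Real.logb 2 ((⌊-Real.logb 2 (q ^ (2 ^ m))⌋₊ + 1 : ℕ) : ℝ) ≤ b + m := by
      have h3 : ((⌊-Real.logb 2 (q ^ (2 ^ m))⌋₊ + 1 : ℕ) : ℝ) ≤ (a + 1) * 2 ^ m := by
        rw [Real.logb_pow, ← mul_neg, ← ha]
        push_cast
        have h4 := Nat.floor_le (a := (2 : ℝ) ^ m * a) (by positivity)
        have h5 : (1 : ℝ) ≤ 2 ^ m := one_le_pow₀ one_le_two
        linarith
      have h4 := Real.logb_le_logb_of_le one_lt_two (by positivity) h3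
      rwa [Real.logb_mul (by positivity) (by positivity), Real.logb_pow 2 2,
        Real.logb_self_eq_one one_lt_two, mul_one] at h4
    have h3 : -(C * (b + m + 2)) ≤ 2 ^ m * x := by
      push_cast at h1 h2
      have := mul_le_mul_of_nonneg_left h2 hC
      linarith
    have h4 : (0 : ℝ) < 2 ^ m := by positivity
    have h5 : -(C * (m ^ 1 / (2 : ℝ) ^ m + (b + 2) * (1 / 2) ^ m)) = -(C * (b + m + 2)) / 2 ^ m := by
      rw [one_div, inv_pow]; field_simp; ring
    rw [h5, div_le_iff₀ h4]
    linarith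
  have lim : Filter.Tendsto (fun m : ℕ => -(C * (m ^ 1 / (2 : ℝ) ^ m + (b + 2) * (1 / 2) ^ m)))
      Filter.atTop (nhds (-(C * (0 + (b + 2) * 0)))) :=
    (((tendsto_pow_const_div_const_pow_of_one_lt 1 one_lt_two).add
      ((tendsto_pow_atTop_nhds_zero_of_lt_one (by norm_num) (by norm_num)).const_mul _)).const_mul _).neg
  have := le_of_tendsto' lim step2
  simpa using this

/-! ### The dot product; passing to the closure -/

section Dot

variable {n k : ℕ}

theorem dot_add_left (c d h : SetVec n) : dot (c + d) h = dot c h + dot d h := by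
  simp [dot, add_mul, Finset.sum_add_distrib]

theorem dot_sub_left (c d h : SetVec n) : dot (c - d) h = dot c h - dot d h := by
  simp [dot, sub_mul, Finset.sum_sub_distrib]

theorem dot_smul_left (r : ℝ) (c h : SetVec n) : dot (r • c) h = r * dot c h := by
  simp [dot, Finset.mul_sum, mul_assoc]

theorem dot_sum_left {ι : Type*} (s : Finset ι) (c : ι → SetVec n) (h : SetVec n) :
    dot (∑ i ∈ s, c i) h = ∑ i ∈ s, dot (c i) h := by
  simp only [dot, Finset.sum_apply, Finset.sum_mul]
  rw [Finset.sum_comm]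

theorem dot_add_right (c h g : SetVec n) : dot c (h + g) = dot c h + dot c g := by
  simp [dot, mul_add, Finset.sum_add_distrib]

theorem dot_smul_right (r : ℝ) (c h : SetVec n) : dot c (r • h) = r * dot c h := by
  simp only [dot, Finset.mul_sum, Pi.smul_apply, smul_eq_mul]
  exact Finset.sum_congr rfl fun α _ => by ring

theorem dot_nsmul_right (m : ℕ) (c h : SetVec n) : dot c (m • h) = m * dot c h := by
  rw [← Nat.cast_smul_eq_nsmul ℝ, dot_smul_right]

theorem continuous_dot (c : SetVec n) : Continuous (dot c) := by
  unfold dot; fun_prop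

/-- The vectors satisfying a max-inequality form a finite union of closed half-spaces. -/
theorem maxValid_closure (S : Set (SetVec n)) (d : Fin k → SetVec n) :
    MaxValid (closure S) d ↔ MaxValid S d := by
  refine ⟨fun h x hx => h x (subset_closure hx), fun h => ?_⟩
  have hcl : IsClosed {x : SetVec n | ∃ j, 0 ≤ dot (d j) x} := by
    rw [Set.ofPred_exists]
    exact isClosed_iUnion_of_finite fun j => isClosed_le continuous_const (continuous_dot _)
  exact closure_minimal h hcl

theorem valid_closure (S : Set (SetVec n)) (c : SetVec n) : Valid (closure S) c ↔ Valid S c := by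
  refine ⟨fun h x hx => h x (subset_closure hx), fun h => ?_⟩
  exact closure_minimal h (isClosed_le continuous_const (continuous_dot c))

end Dot

theorem iip_almostEntropicRegion : IIP almostEntropicRegion = IIP entropicRegion := by
  funext x
  simp only [IIP, almostEntropicRegion, valid_closure]

theorem groupBalancedMaxIIP_almostEntropicRegion :
    GroupBalancedMaxIIP almostEntropicRegion = GroupBalancedMaxIIP entropicRegion := by
  funext x
  simp only [GroupBalancedMaxIIP, almostEntropicRegion, maxValid_closure]

/-! ### Max-inequalities as nonnegative combinations -/

section Convex

variable {n k : ℕ}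

/-- The vectors with an entropic positive multiple. -/
def entropicRays (n : ℕ) : Set (SetVec n) := {x | ∃ m : ℕ, 0 < m ∧ m • x ∈ entropicRegion n}

theorem add_mem_closure_entropicRays {x y : SetVec n} (hx : x ∈ closure (entropicRays n))
    (hy : y ∈ closure (entropicRays n)) : x + y ∈ closure (entropicRays n) := by
  refine map_mem_closure₂ continuous_add hx hy ?_
  rintro a ⟨m, hm, ha⟩ b ⟨m', hm', hb⟩
  refine ⟨m * m', Nat.mul_pos hm hm', ?_⟩
  have h1 := nsmul_mem_entropicRegion ha m'
  have h2 := nsmul_mem_entropicRegion hb m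
  rw [smul_smul] at h1 h2
  rw [smul_add, mul_comm m m']
  rw [mul_comm m m'] at h2
  exact add_mem_entropicRegion h1 h2

theorem smul_mem_closure_entropicRays {x : SetVec n} (hx : x ∈ closure (entropicRays n))
    {r : ℝ} (hr : 0 ≤ r) : r • x ∈ closure (entropicRays n) := by
  -- A real factor is approximated by ⌊rN⌋ / N, whose denominator is absorbed into the multiple `m`.
  have hr' : r ∈ closure {s : ℝ | ∃ p q : ℕ, 0 < q ∧ s = p / q} := by
    have := (tendsto_nat_floor_mul_div_atTop hr).comp tendsto_natCast_atTop_atTop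
    refine mem_closure_of_tendsto this ?_
    filter_upwards [Filter.eventually_gt_atTop 0] with N hN
    exact ⟨_, N, hN, rfl⟩
  refine map_mem_closure₂ continuous_smul hr' hx ?_
  rintro s ⟨p, q, hq, rfl⟩ a ⟨m, hm, ha⟩
  refine ⟨m * q, Nat.mul_pos hm hq, ?_⟩
  have h1 := nsmul_mem_entropicRegion ha p
  convert h1 using 1
  have hq' : (q : ℝ) ≠ 0 := by exact_mod_cast hq.ne'
  simp only [← Nat.cast_smul_eq_nsmul ℝ, smul_smul]
  congr 1
  push_cast
  field_simp

theorem convex_closure_entropicRays : Convex ℝ (closure (entropicRays n)) :=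
  fun _ hx _ hy _ _ ha hb _ =>
    add_mem_closure_entropicRays (smul_mem_closure_entropicRays hx ha)
      (smul_mem_closure_entropicRays hy hb)

/-- A max-inequality is valid iff some nonzero nonnegative combination is a valid inequality. -/
theorem maxValid_iff (d : Fin k → SetVec n) :
    MaxValid (entropicRegion n) d ↔
      ∃ w : Fin k → ℝ, (∀ j, 0 ≤ w j) ∧ w ≠ 0 ∧ Valid (entropicRegion n) (∑ j, w j • d j) := by
  constructor
  · intro h
    have hK : MaxValid (closure (entropicRays n)) d := by
      rw [maxValid_closure]
      rintro x ⟨m, hm, hx⟩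
      obtain ⟨j, hj⟩ := h _ hx
      rw [dot_nsmul_right] at hj
      exact ⟨j, nonneg_of_mul_nonneg_right hj (by exact_mod_cast hm)⟩
    let D : SetVec n →ₗ[ℝ] (Fin k → ℝ) :=
      { toFun := fun x j => dot (d j) x
        map_add' := fun x y => funext fun j => dot_add_right _ _ _
        map_smul' := fun r x => funext fun j => dot_smul_right _ _ _ }
    have hs1 : Convex ℝ {x : Fin k → ℝ | ∀ j, x j < 0} := by
      intro x hx y hy a b ha hb hab j
      simp only [Pi.add_apply, Pi.smul_apply, smul_eq_mul]
      have := hx j; have := hy j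
      rcases ha.eq_or_lt with rfl | ha
      · simp only [zero_add] at hab; subst hab; simpa using hy j
      · nlinarith
    have hs2 : IsOpen {x : Fin k → ℝ | ∀ j, x j < 0} := by
      rw [Set.ofPred_forall]
      exact isOpen_iInter_of_finite fun j => isOpen_lt (continuous_apply j) continuous_const
    have hdisj : Disjoint {x : Fin k → ℝ | ∀ j, x j < 0} (D '' closure (entropicRays n)) := by
      rw [Set.disjoint_left]
      rintro _ hx ⟨y, hy, rfl⟩
      obtain ⟨j, hj⟩ := hK y hy
      exact absurd (hx j) (not_lt.2 hj)
    -- The convex image of the cone misses the open negative orthant. The coefficients of a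
    -- separating functional are the weights `w`. They are nonnegative because `f` is positive on 1
    -- + N e_j for every N, and the combination is valid because `f` is bounded below along the
    -- multiples of each entropic vector.
    obtain ⟨f, u, hf1, hf2⟩ := geometric_hahn_banach_open hs1 hs2
      (convex_closure_entropicRays.linear_image D) hdisj
    have hmem : ∀ x ∈ entropicRegion n, x ∈ closure (entropicRays n) := fun x hx =>
      subset_closure ⟨1, one_pos, by simpa using hx⟩
    have hu : u ≤ 0 := by
      have := hf2 (D 0) ⟨0, hmem 0 zero_mem_entropicRegion, rfl⟩
      simpa using this
    have hpos : ∀ x : Fin k → ℝ, (∀ j, 0 < x j) → 0 < f x := by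
      intro x hx
      have := hf1 (-x) (fun j => by simpa using hx j)
      rw [map_neg] at this
      linarith
    have hfe : ∀ x, f x = ∑ j, f (Pi.single j 1) * x j := by
      intro x
      conv_lhs => rw [pi_eq_sum_univ' x]
      rw [map_sum]
      refine Finset.sum_congr rfl fun j _ => ?_
      rw [map_smul, smul_eq_mul, mul_comm]
    refine ⟨fun j => f (Pi.single j 1), fun j => ?_, ?_, ?_⟩
    · by_contra hneg
      push Not at hneg
      obtain ⟨N, hN⟩ := exists_nat_gt (f 1 / -f (Pi.single j 1))
      have h1 := hpos (1 + (N : ℝ) • Pi.single j 1) (fun i => by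
        have : (0 : ℝ) ≤ (Pi.single j 1 : Fin k → ℝ) i := by
          by_cases hij : i = j
          · subst hij; simp
          · simp [hij]
        simp only [Pi.add_apply, Pi.one_apply, Pi.smul_apply, smul_eq_mul]
        positivity)
      rw [map_add, map_smul, smul_eq_mul] at h1
      rw [div_lt_iff₀ (by linarith)] at hN
      linarith
    · intro h0
      have h1 := hpos 1 (fun _ => one_pos)
      rw [hfe] at h1
      have h2 : ∀ j, f (Pi.single j 1) = 0 := fun j => congrFun h0 j
      simp [h2] at h1
    · intro x hx
      rw [dot_sum_left]
      simp only [dot_smul_left]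
      have e : ∑ j, f (Pi.single j 1) * dot (d j) x = f (D x) := (hfe _).symm
      rw [e]
      by_contra hneg
      push Not at hneg
      obtain ⟨N, hN⟩ := exists_nat_gt (u / f (D x))
      have h1 := hf2 (D ((N : ℝ) • x)) ⟨_, by
        rw [Nat.cast_smul_eq_nsmul]; exact hmem _ (nsmul_mem_entropicRegion hx N), rfl⟩
      rw [map_smul, map_smul, smul_eq_mul] at h1
      rw [div_lt_iff_of_neg hneg] at hN
      linarith
  · rintro ⟨w, hw0, hw, hv⟩ x hx
    by_contra hc
    push Not at hc
    obtain ⟨i, hi⟩ := Function.ne_iff.1 hw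
    have h1 := hv x hx
    rw [dot_sum_left] at h1
    simp only [dot_smul_left] at h1
    have h2 : ∑ j, w j * dot (d j) x < 0 := by
      refine Finset.sum_neg' (fun j _ => mul_nonpos_of_nonneg_of_nonpos (hw0 j) (hc j).le)
        ⟨i, Finset.mem_univ i, mul_neg_of_pos_of_neg ((hw0 i).lt_of_ne fun e => hi e.symm) (hc i)⟩
    linarith

end Convex

/-! ### Balanced inequalities and group-balanced families -/

section Balanced

variable {n k : ℕ}

/-- The coefficient vector of the inequality `h(j | rest) ≥ 0`. -/
def privateInfo (j : Fin n) : SetVec n :=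
  Pi.single Finset.univ 1 - Pi.single (Finset.univ.erase j) 1

theorem dot_single (β : Finset (Fin n)) (h : SetVec n) : dot (Pi.single β 1) h = h β := by
  simp [dot, Pi.single_apply]

theorem dot_privateInfo (j : Fin n) (h : SetVec n) :
    dot (privateInfo j) h = h Finset.univ - h (Finset.univ.erase j) := by
  rw [privateInfo, dot_sub_left, dot_single, dot_single]

theorem dot_privateInfo_basicModular (i j : Fin n) :
    dot (privateInfo j) (basicModular i) = if i = j then 1 else 0 := by
  rw [dot_privateInfo]
  by_cases h : i = j <;> simp [basicModular, h]

theorem privateInfo_nonneg (j : Fin n) : Valid (entropicRegion n) (privateInfo j) := by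
  intro h hh
  obtain ⟨q, hq, Ω, _, P, X, hP, h1, hX⟩ := exists_rep hh
  rw [dot_privateInfo, hX, hX, sub_nonneg]
  refine ent_mono (fun ω => hq.trans_le (hP ω)) fun ω ω' h => ?_
  rw [tuple_eq_iff] at h ⊢
  exact fun i _ => h i (Finset.mem_univ i)

/-- The balanced version of an inequality. -/
noncomputable def balanced (c : SetVec n) : SetVec n :=
  c - ∑ j, dot c (basicModular j) • privateInfo j

theorem dot_balanced_basicModular (c : SetVec n) (i : Fin n) :
    dot (balanced c) (basicModular i) = 0 := by
  simp [balanced, dot_sub_left, dot_sum_left, dot_smul_left, dot_privateInfo_basicModular]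

/-- An inequality is valid iff its balanced version is valid and its residual weights are
nonnegative. -/
theorem valid_iff_balanced (c : SetVec n) : Valid (entropicRegion n) c ↔
    (∀ j, 0 ≤ dot c (basicModular j)) ∧ Valid (entropicRegion n) (balanced c) := by
  constructor
  · intro hc
    refine ⟨fun j => hc _ (basicModular_mem_entropicRegion j), ?_⟩
    -- The variables are treated one at a time. The vectors `privateInfo j` are dual to the
    -- `basicModular i`, so earlier subtractions leave the weight at a new variable unchanged.
    have key : ∀ S : Finset (Fin n), Valid (entropicRegion n)
        (c - ∑ j ∈ S, dot c (basicModular j) • privateInfo j) := by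
      classical
      intro S
      induction S using Finset.induction_on with
      | empty => simpa using hc
      | insert i S hi ih =>
        intro h hh
        have h1 := ih.sub_private i hh
        have h2 : dot (c - ∑ j ∈ S, dot c (basicModular j) • privateInfo j) (basicModular i) =
            dot c (basicModular i) := by
          simp [dot_sub_left, dot_sum_left, dot_smul_left, dot_privateInfo_basicModular, hi]
        rw [h2, dot_sub_left] at h1
        rw [Finset.sum_insert hi, dot_sub_left, dot_add_left, dot_smul_left, dot_privateInfo]
        linarith
    exact key Finset.univ
  · rintro ⟨h0, hb⟩ h hh
    have h1 := hb h hh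
    have h2 : 0 ≤ ∑ j, dot c (basicModular j) * dot (privateInfo j) h :=
      Finset.sum_nonneg fun j _ => mul_nonneg (h0 j) (privateInfo_nonneg j h hh)
    simp only [balanced, dot_sub_left, dot_sum_left, dot_smul_left] at h1
    linarith

theorem IsModular.eq_sum {h : SetVec n} (hm : IsModular h) (α : Finset (Fin n)) :
    h α = ∑ j, h {j} * basicModular j α := by
  classical
  have h1 : h α = ∑ j ∈ α, h {j} := by
    induction α using Finset.induction_on with
    | empty => simpa using hm.1
    | insert i S hi ih =>
      have h2 := hm.2 {i} S
      rw [Finset.singleton_inter_of_notMem hi, hm.1, ← Finset.insert_eq] at h2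
      rw [Finset.sum_insert hi, ← ih]
      linarith
  rw [h1]
  simp [basicModular]

/-- Makes condition (b) linear algebra: the values of the modular function at singletons form a
positive vector in the kernel of the weight matrix. -/
theorem IsModular.dot_eq {h : SetVec n} (hm : IsModular h) (d : SetVec n) :
    dot d h = ∑ j, dot d (basicModular j) * h {j} := by
  have : h = ∑ j, h {j} • basicModular j := by
    funext α
    rw [hm.eq_sum α]
    simp
  conv_lhs => rw [this]
  simp only [dot, Finset.sum_apply, Finset.mul_sum, Finset.sum_mul]
  rw [Finset.sum_comm]
  refine Finset.sum_congr rfl fun j _ => Finset.sum_congr rfl fun α _ => ?_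
  simp only [Pi.smul_apply, smul_eq_mul]
  ring

theorem isModular_sum (μ : Fin n → ℝ) : IsModular (fun α => ∑ j ∈ α, μ j) :=
  ⟨by simp, fun α β => (Finset.sum_union_inter).symm⟩

/-- The matrix of the residual weights of a family. -/
def weights (d : Fin k → SetVec n) : Matrix (Fin k) (Fin n) ℝ :=
  Matrix.of fun i j => dot (d i) (basicModular j)

theorem rank_add_one_iff (A : Matrix (Fin k) (Fin n) ℝ) :
    A.rank + 1 = k ↔ Module.finrank ℝ (LinearMap.ker A.vecMulLinear) = 1 := by
  have h1 := LinearMap.finrank_range_add_finrank_ker A.vecMulLinear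
  have h2 : Module.finrank ℝ (LinearMap.range A.vecMulLinear) = A.rank := by
    rw [← Matrix.rank_transpose, Matrix.rank, Matrix.mulVecLin_transpose]
  rw [h2, Module.finrank_fin_fun] at h1
  omega

theorem IsGroupBalanced.exists_mul {d : Fin k → SetVec n} (hd : IsGroupBalanced d)
    {w v : Fin k → ℝ} (hw : Matrix.vecMul w (weights d) = 0) (hw0 : w ≠ 0)
    (hv : Matrix.vecMul v (weights d) = 0) : ∃ r : ℝ, v = r • w := by
  have h1 := (rank_add_one_iff (weights d)).1 hd.1
  let w' : LinearMap.ker (weights d).vecMulLinear := ⟨w, by simpa using hw⟩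
  let v' : LinearMap.ker (weights d).vecMulLinear := ⟨v, by simpa using hv⟩
  have hw' : w' ≠ 0 := fun h => hw0 (congrArg Subtype.val h)
  obtain ⟨r, hr⟩ := (finrank_eq_one_iff_of_nonzero' w' hw').1 h1 v'
  exact ⟨r, (congrArg Subtype.val hr).symm⟩

theorem IsGroupBalanced.exists_ker {d : Fin k → SetVec n} (hd : IsGroupBalanced d) :
    ∃ w : Fin k → ℝ, Matrix.vecMul w (weights d) = 0 ∧ w ≠ 0 := by
  have h1 := (rank_add_one_iff (weights d)).1 hd.1
  obtain ⟨v, hv, -⟩ := finrank_eq_one_iff'.1 h1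
  exact ⟨v.1, LinearMap.mem_ker.1 v.2, fun h => hv (Subtype.ext h)⟩

/-- A nonnegative vA pairs to zero with the positive kernel vector of A, hence vanishes entry by
entry. -/
theorem IsGroupBalanced.vecMul_eq_zero {d : Fin k → SetVec n} (hd : IsGroupBalanced d)
    {v : Fin k → ℝ} (hv : ∀ j, 0 ≤ Matrix.vecMul v (weights d) j) :
    Matrix.vecMul v (weights d) = 0 := by
  obtain ⟨-, h, hm, hpos, h0⟩ := hd
  have h1 : ∑ j, Matrix.vecMul v (weights d) j * h {j} = 0 := by
    have : Matrix.mulVec (weights d) (fun j => h {j}) = 0 := by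
      funext i
      rw [Pi.zero_apply, ← h0 i, hm.dot_eq]
      rfl
    change Matrix.vecMul v (weights d) ⬝ᵥ (fun j => h {j}) = 0
    rw [← Matrix.dotProduct_mulVec, this, dotProduct_zero]
  funext j
  have hp : ∀ j, 0 < h {j} := fun j => hpos _ (Finset.singleton_nonempty j)
  have h2 := (Finset.sum_eq_zero_iff_of_nonneg
    (fun j _ => mul_nonneg (hv j) (hp j).le)).1 h1 j (Finset.mem_univ j)
  exact (mul_eq_zero.1 h2).resolve_right (hp j).ne'

theorem IsGroupBalanced.exists_of_maxValid {d : Fin k → SetVec n} (hd : IsGroupBalanced d)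
    (hv : MaxValid (entropicRegion n) d) : ∃ w : Fin k → ℝ, (∀ j, 0 ≤ w j) ∧ w ≠ 0 ∧
      Matrix.vecMul w (weights d) = 0 ∧ Valid (entropicRegion n) (∑ j, w j • d j) := by
  obtain ⟨w, h0, hw, hv⟩ := (maxValid_iff d).1 hv
  refine ⟨w, h0, hw, hd.vecMul_eq_zero fun j => ?_, hv⟩
  have := hv _ (basicModular_mem_entropicRegion j)
  rw [dot_sum_left] at this
  simp only [dot_smul_left] at this
  exact this

/-- The combination witnessing validity lies in the left kernel, which is a line, so it is
proportional to `w`; both being nonnegative, the factor has the right sign. -/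
theorem IsGroupBalanced.maxValid_iff {d : Fin k → SetVec n} (hd : IsGroupBalanced d)
    {w : Fin k → ℝ} (hw : Matrix.vecMul w (weights d) = 0) (hw0 : w ≠ 0) (hwn : ∀ j, 0 ≤ w j) :
    MaxValid (entropicRegion n) d ↔ Valid (entropicRegion n) (∑ j, w j • d j) := by
  refine ⟨fun h => ?_, fun h => (InfoIneq.maxValid_iff d).2 ⟨w, hwn, hw0, h⟩⟩
  obtain ⟨v, hv0, hv, hvk, hval⟩ := hd.exists_of_maxValid h
  obtain ⟨r, rfl⟩ := hd.exists_mul hvk hv hw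
  have hr : 0 ≤ r := by
    obtain ⟨i, hi⟩ := Function.ne_iff.1 hv
    have hi' : 0 < v i := (hv0 i).lt_of_ne fun e => hi e.symm
    exact nonneg_of_mul_nonneg_left (hwn i) hi'
  intro x hx
  have h1 := mul_nonneg hr (hval x hx)
  rw [dot_sum_left] at h1 ⊢
  simp only [dot_smul_left, Pi.smul_apply, smul_eq_mul, Finset.mul_sum, mul_assoc] at h1 ⊢
  exact h1

/-- A line spanned by a vector of mixed signs contains no nonzero nonnegative vector. -/
theorem IsGroupBalanced.not_maxValid {d : Fin k → SetVec n} (hd : IsGroupBalanced d)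
    {w : Fin k → ℝ} (hw : Matrix.vecMul w (weights d) = 0) {i j : Fin k} (hi : 0 < w i)
    (hj : w j < 0) : ¬ MaxValid (entropicRegion n) d := by
  intro h
  obtain ⟨v, hv0, hv, hvk, -⟩ := hd.exists_of_maxValid h
  obtain ⟨r, rfl⟩ := hd.exists_mul hvk hv hw
  simp only [Pi.smul_apply, smul_eq_mul] at hi hj
  have h1 := hv0 i
  have h2 := hv0 j
  rcases le_total 0 r with hr | hr
  · exact absurd (mul_nonneg hr h2) (not_le.2 hj)
  · exact absurd (mul_nonpos_of_nonpos_of_nonneg hr h1) (not_le.2 hi)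

/-- The form that certificates can verify: evaluation at `i₀` is injective on the left kernel and
nonzero at `w`, so this kernel is a line. -/
theorem isGroupBalanced_of {d : Fin k → SetVec n} {w : Fin k → ℝ}
    (hw : Matrix.vecMul w (weights d) = 0) {i₀ : Fin k} (hw0 : w i₀ ≠ 0)
    (hker : ∀ v, Matrix.vecMul v (weights d) = 0 → v i₀ = 0 → v = 0)
    {μ : Fin n → ℝ} (hμ : ∀ j, 0 < μ j) (hμ0 : Matrix.mulVec (weights d) μ = 0) :
    IsGroupBalanced d := by
  refine ⟨(rank_add_one_iff (weights d)).2 ?_, fun α => ∑ j ∈ α, μ j, isModular_sum μ,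
    fun α hα => Finset.sum_pos (fun j _ => hμ j) hα, fun i => ?_⟩
  · refine finrank_eq_one_iff'.2 ⟨⟨w, by simpa using hw⟩, fun h => hw0 ?_, fun v => ⟨v.1 i₀ / w i₀, ?_⟩⟩
    · exact congrFun (congrArg Subtype.val h) i₀
    · refine Subtype.ext (sub_eq_zero.1 (hker _ ?_ ?_))
      · have hv : Matrix.vecMul v.1 (weights d) = 0 := LinearMap.mem_ker.1 v.2
        simp only [SetLike.val_smul]
        rw [Matrix.sub_vecMul, Matrix.smul_vecMul, hw, hv]; simp
      · simp [hw0]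
  · rw [(isModular_sum μ).dot_eq]
    simp only [Finset.sum_singleton]
    exact congrFun hμ0 i

end Balanced

section Single

variable {n : ℕ}

/-- The weight matrix is zero: its rank is 0 = k - 1, and every positive modular function is
orthogonal. -/
theorem isGroupBalanced_single {d : Fin 1 → SetVec n}
    (h : ∀ j, dot (d 0) (basicModular j) = 0) : IsGroupBalanced d := by
  have h0 : weights d = 0 := by
    ext i j
    rw [Subsingleton.elim i 0]
    exact h j
  refine isGroupBalanced_of (w := 1) (i₀ := 0) (by simp [h0]) (by simp) (fun v _ hv => ?_)
    (μ := 1) (fun _ => one_pos) (by simp [h0])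
  funext i
  rw [Subsingleton.elim i 0]
  exact hv

theorem maxValid_single (S : Set (SetVec n)) (d : Fin 1 → SetVec n) :
    MaxValid S d ↔ Valid S (d 0) := by
  simp [MaxValid, Valid]

end Single

/-! ### Integral certificates from linear duality -/

section Rational

/-- The rational solutions of a homogeneous system with integer coefficients are dense in the
real ones. -/
theorem exists_int_solution {ι κ : Type} [Fintype κ] (M : Matrix ι κ ℤ) {S : Set (κ → ℝ)}
    (hS : IsOpen S) (hcone : ∀ x ∈ S, ∀ r : ℝ, 0 < r → r • x ∈ S) {x : κ → ℝ} (hx : x ∈ S)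
    (hM : Matrix.mulVec (M.map ((↑) : ℤ → ℝ)) x = 0) :
    ∃ z : κ → ℤ, Matrix.mulVec M z = 0 ∧ (fun i => (z i : ℝ)) ∈ S := by
  classical
  -- Expanding the coordinates of `x` in a ℚ-basis of their span writes `x` as a real combination of
  -- rational vectors, each of which solves the system by independence of the basis. Replacing the
  -- real coefficients by nearby rationals stays in the open set; clearing denominators stays in the
  -- cone.
  let V := Submodule.span ℚ (Set.range x)
  have : FiniteDimensional ℚ V := FiniteDimensional.span_of_finite ℚ (Set.finite_range x)
  let b := Module.finBasis ℚ V
  let y : Fin (Module.finrank ℚ V) → κ → ℚ := fun t i =>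
    b.repr ⟨x i, Submodule.subset_span (Set.mem_range_self i)⟩ t
  have hy : ∀ i, x i = ∑ t, (y t i : ℝ) * (b t : ℝ) := by
    intro i
    have h := congrArg Subtype.val (b.sum_repr ⟨x i, Submodule.subset_span (Set.mem_range_self i)⟩)
    simp only [AddSubmonoidClass.coe_finsetSum, Submodule.coe_smul, Rat.smul_def] at h
    exact h.symm
  have hMy : ∀ t j, ∑ i, (M j i : ℚ) * y t i = 0 := by
    intro t j
    have h1 : ∑ t, (∑ i, (M j i : ℚ) * y t i) • b t = 0 := by
      apply Subtype.ext
      simp only [AddSubmonoidClass.coe_finsetSum, Submodule.coe_smul, Rat.smul_def,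
        ZeroMemClass.coe_zero]
      have h2 := congrFun hM j
      simp only [Matrix.mulVec, dotProduct, Matrix.map_apply, Pi.zero_apply, hy,
        Finset.mul_sum] at h2
      rw [Finset.sum_comm] at h2
      rw [← h2]
      refine Finset.sum_congr rfl fun t _ => ?_
      push_cast
      rw [Finset.sum_mul]
      exact Finset.sum_congr rfl fun i _ => by ring
    exact Fintype.linearIndependent_iff.1 b.linearIndependent _ h1 t
  let F : (Fin (Module.finrank ℚ V) → ℝ) → κ → ℝ := fun c i => ∑ t, (y t i : ℝ) * c t
  have hF : Continuous F := by fun_prop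
  have hFb : F (fun t => (b t : ℝ)) ∈ S := by
    have : F (fun t => (b t : ℝ)) = x := funext fun i => (hy i).symm
    rwa [this]
  obtain ⟨c, hc⟩ := (DenseRange.piMap fun _ : Fin (Module.finrank ℚ V) =>
    Rat.denseRange_cast (𝕜 := ℝ)).exists_mem_open (hS.preimage hF) ⟨_, hFb⟩
  let z : κ → ℚ := fun i => ∑ t, y t i * c t
  have hz : F (Pi.map (fun _ => Rat.cast) c) = fun i => (z i : ℝ) := by
    funext i; simp [F, z]
  have hz0 : ∀ j, ∑ i, (M j i : ℚ) * z i = 0 := by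
    intro j
    simp only [z, Finset.mul_sum]
    rw [Finset.sum_comm]
    refine Finset.sum_eq_zero fun t _ => ?_
    have := congrArg (· * c t) (hMy t j)
    simp only [Finset.sum_mul, zero_mul] at this
    rw [← this]
    exact Finset.sum_congr rfl fun i _ => by ring
  let N : ℕ := ∏ i, (z i).den
  have hN : 0 < N := Finset.prod_pos fun i _ => (z i).den_pos
  have hint : ∀ i, ∃ m : ℤ, (m : ℚ) = N * z i := by
    intro i
    obtain ⟨e, he⟩ : (z i).den ∣ N := Finset.dvd_prod_of_mem _ (Finset.mem_univ i)
    refine ⟨e * (z i).num, ?_⟩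
    rw [he]
    push_cast
    have := Rat.den_mul_eq_num (z i)
    rw [mul_comm ((z i).den : ℚ), mul_assoc, this]
  choose m hm using hint
  refine ⟨m, ?_, ?_⟩
  · funext j
    have : ((∑ i, M j i * m i : ℤ) : ℚ) = 0 := by
      push_cast
      simp only [hm]
      have := congrArg ((N : ℚ) * ·) (hz0 j)
      simp only [Finset.mul_sum, mul_zero] at this
      rw [← this]
      exact Finset.sum_congr rfl fun i _ => by ring
    exact_mod_cast this
  · have h1 := hcone _ hc N (by exact_mod_cast hN)
    rw [hz] at h1
    convert h1 using 1
    funext i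
    have := congrArg (fun q : ℚ => (q : ℝ)) (hm i)
    simpa using this

variable {k n : ℕ}

/-- Stiemke's lemma. -/
theorem exists_pos_ker_or (A : Matrix (Fin k) (Fin n) ℝ) :
    (∃ μ, (∀ j, 0 < μ j) ∧ Matrix.mulVec A μ = 0) ∨
      ∃ v, (∀ j, 0 ≤ Matrix.vecMul v A j) ∧ ∃ j, 0 < Matrix.vecMul v A j := by
  by_contra! hcon
  obtain ⟨h1, h2⟩ := hcon
  have hs1 : Convex ℝ {x : Fin n → ℝ | ∀ j, 0 < x j} := by
    intro x hx y hy a b ha hb hab j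
    simp only [Pi.add_apply, Pi.smul_apply, smul_eq_mul]
    have := hx j; have := hy j
    rcases ha.eq_or_lt with rfl | ha
    · simp only [zero_add] at hab; subst hab; simpa using hy j
    · nlinarith
  have hs2 : IsOpen {x : Fin n → ℝ | ∀ j, 0 < x j} := by
    rw [Set.ofPred_forall]
    exact isOpen_iInter_of_finite fun j => isOpen_lt continuous_const (continuous_apply j)
  obtain ⟨f, u, hf1, hf2⟩ := geometric_hahn_banach_open hs1 hs2
    (LinearMap.ker A.mulVecLin).convex (Set.disjoint_left.2 fun x hx hx' => h1 x hx hx')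
  have hu : u ≤ 0 := by simpa using hf2 0 (Submodule.zero_mem _)
  have hker : ∀ x, Matrix.mulVec A x = 0 → f x = 0 := by
    have hge : ∀ x, Matrix.mulVec A x = 0 → 0 ≤ f x := by
      intro x hx
      by_contra hneg
      push Not at hneg
      obtain ⟨N, hN⟩ := exists_nat_gt (u / f x)
      have h3 := hf2 ((N : ℝ) • x) (by
        simp only [SetLike.mem_coe, LinearMap.mem_ker, Matrix.mulVecLin_apply, Matrix.mulVec_smul, hx,
          smul_zero])
      rw [map_smul, smul_eq_mul] at h3
      rw [div_lt_iff_of_neg hneg] at hN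
      linarith
    intro x hx
    refine le_antisymm ?_ (hge x hx)
    have := hge (-x) (by rw [Matrix.mulVec_neg, hx, neg_zero])
    rw [map_neg] at this
    linarith
  -- The functional separating the positive orthant from the kernel vanishes on the kernel, so it
  -- factors through `A`; this produces `v` with vA = -f.
  have hmem : (-f : (Fin n → ℝ) →L[ℝ] ℝ).toLinearMap ∈ LinearMap.range A.mulVecLin.dualMap := by
    rw [LinearMap.range_dualMap_eq_dualAnnihilator_ker, Submodule.mem_dualAnnihilator]
    intro x hx
    have : Matrix.mulVec A x = 0 := by simpa using hx
    simp [hker x this]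
  obtain ⟨g, hg⟩ := hmem
  have hg' : ∀ x, g (Matrix.mulVec A x) = -f x := fun x => by
    simpa using LinearMap.congr_fun hg x
  let v : Fin k → ℝ := fun i => g (Pi.single i 1)
  have hgv : ∀ y, g y = v ⬝ᵥ y := by
    intro y
    conv_lhs => rw [pi_eq_sum_univ' y]
    rw [map_sum]
    refine Finset.sum_congr rfl fun j _ => ?_
    rw [map_smul, smul_eq_mul, mul_comm]
  have hfv : ∀ x, Matrix.vecMul v A ⬝ᵥ x = -f x := fun x => by
    rw [← Matrix.dotProduct_mulVec, ← hgv, hg']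
  have hpos : ∀ x : Fin n → ℝ, (∀ j, 0 < x j) → 0 < Matrix.vecMul v A ⬝ᵥ x := by
    intro x hx
    have := hf1 x hx
    rw [hfv]; linarith
  have hnn : ∀ j, 0 ≤ Matrix.vecMul v A j := by
    intro j
    by_contra hneg
    push Not at hneg
    obtain ⟨N, hN⟩ := exists_nat_gt (Matrix.vecMul v A ⬝ᵥ 1 / -Matrix.vecMul v A j)
    have h3 := hpos (1 + (N : ℝ) • Pi.single j 1) (fun i => by
      have : (0 : ℝ) ≤ (Pi.single j 1 : Fin n → ℝ) i := by
        by_cases hij : i = j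
        · subst hij; simp
        · simp [hij]
      simp only [Pi.add_apply, Pi.one_apply, Pi.smul_apply, smul_eq_mul]
      positivity)
    rw [dotProduct_add, dotProduct_smul, dotProduct_single_one, smul_eq_mul] at h3
    rw [div_lt_iff₀ (by linarith)] at hN
    linarith
  have h4 := hpos 1 fun _ => one_pos
  have h5 : Matrix.vecMul v A ⬝ᵥ 1 ≤ 0 :=
    Finset.sum_nonpos fun j _ => by simpa using h2 v hnn j
  linarith

theorem exists_mulVec_single {ι κ : Type} [Fintype ι] [Fintype κ] [DecidableEq ι]
    (A : Matrix ι κ ℝ) (hA : ∀ v, Matrix.vecMul v A = 0 → v = 0) (i : ι) :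
    ∃ b, Matrix.mulVec A b = Pi.single i 1 := by
  have hinj : Function.Injective A.vecMul := by
    intro v w h
    refine sub_eq_zero.1 (hA _ ?_)
    rw [Matrix.sub_vecMul]
    exact sub_eq_zero.2 h
  have h1 : A.rank = Fintype.card ι := (Matrix.vecMul_injective_iff.1 hinj).rank_matrix
  have h2 : LinearMap.range A.mulVecLin = ⊤ := by
    apply Submodule.eq_top_of_finrank_eq
    rw [Module.finrank_fintype_fun_eq_card, ← h1]
    rfl
  have h3 : (Pi.single i 1 : ι → ℝ) ∈ LinearMap.range A.mulVecLin := h2 ▸ Submodule.mem_top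
  obtain ⟨b, hb⟩ := h3
  exact ⟨b, by simpa using hb⟩

/-- `B` certifies that a left kernel vector of `A` that vanishes on `Z` is zero. -/
def KerCert (A : Matrix (Fin k) (Fin n) ℤ) (Z : Set (Fin k)) (B : Fin k → Fin n → ℤ) : Prop :=
  ∀ i ∉ Z, Matrix.mulVec A (B i) i ≠ 0 ∧ ∀ i' ∉ Z, i' ≠ i → Matrix.mulVec A (B i) i' = 0

theorem map_mulVec (A : Matrix (Fin k) (Fin n) ℤ) (b : Fin n → ℤ) (i : Fin k) :
    Matrix.mulVec (A.map ((↑) : ℤ → ℝ)) (fun j => (b j : ℝ)) i = (Matrix.mulVec A b i : ℤ) := by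
  simp [Matrix.mulVec, dotProduct]

theorem map_vecMul (A : Matrix (Fin k) (Fin n) ℤ) (w : Fin k → ℤ) (j : Fin n) :
    Matrix.vecMul (fun i => (w i : ℝ)) (A.map ((↑) : ℤ → ℝ)) j = (Matrix.vecMul w A j : ℤ) := by
  simp [Matrix.vecMul, dotProduct]

theorem KerCert.eq_zero {A : Matrix (Fin k) (Fin n) ℤ} {Z : Set (Fin k)} {B : Fin k → Fin n → ℤ}
    (h : KerCert A Z B) {v : Fin k → ℝ} (hv : Matrix.vecMul v (A.map ((↑) : ℤ → ℝ)) = 0)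
    (hZ : ∀ i ∈ Z, v i = 0) : v = 0 := by
  funext i
  by_cases hi : i ∈ Z
  · exact hZ i hi
  obtain ⟨h1, h2⟩ := h i hi
  have h3 : v ⬝ᵥ Matrix.mulVec (A.map ((↑) : ℤ → ℝ)) (fun j => (B i j : ℝ)) = 0 := by
    rw [Matrix.dotProduct_mulVec, hv, zero_dotProduct]
  have h4 : v ⬝ᵥ Matrix.mulVec (A.map ((↑) : ℤ → ℝ)) (fun j => (B i j : ℝ)) =
      v i * (Matrix.mulVec A (B i) i : ℤ) := by
    unfold dotProduct
    rw [Finset.sum_eq_single i]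
    · rw [map_mulVec]
    · intro i' _ hi'
      by_cases hz : i' ∈ Z
      · rw [hZ i' hz, zero_mul]
      · rw [map_mulVec, h2 i' hz hi']; simp
    · simp
  rw [h4] at h3
  exact (mul_eq_zero.1 h3).resolve_right (by exact_mod_cast h1)

/-- The rows outside Z are independent, so `A` restricted to them is onto and a unit vector has a
preimage. Asking only for a nonzero entry at `i` makes the requirement an open cone within a
homogeneous system, hence integrally solvable. -/
theorem exists_kerCert (A : Matrix (Fin k) (Fin n) ℤ) (Z : Set (Fin k))
    (hker : ∀ v, Matrix.vecMul v (A.map ((↑) : ℤ → ℝ)) = 0 → (∀ i ∈ Z, v i = 0) → v = 0) :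
    ∃ B, KerCert A Z B := by
  classical
  have key : ∀ i, ∃ b : Fin n → ℤ, i ∉ Z →
      Matrix.mulVec A b i ≠ 0 ∧ ∀ i' ∉ Z, i' ≠ i → Matrix.mulVec A b i' = 0 := by
    intro i
    by_cases hi : i ∈ Z
    · exact ⟨0, fun h => absurd hi h⟩
    let A' : Matrix {i // i ∉ Z} (Fin n) ℝ := (A.map ((↑) : ℤ → ℝ)).submatrix Subtype.val id
    have hA' : ∀ v, Matrix.vecMul v A' = 0 → v = 0 := by
      intro v hv
      let v' : Fin k → ℝ := fun i => if h : i ∉ Z then v ⟨i, h⟩ else 0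
      have h1 : v' = 0 := by
        refine hker v' ?_ fun i hi => by simp [v', hi]
        rw [← hv]
        funext j
        have e1 : Matrix.vecMul v A' j = ∑ i : {i // i ∉ Z}, v' i.1 * (A i.1 j : ℝ) := by
          change ∑ i, v i * A' i j = _
          refine Finset.sum_congr rfl fun i _ => ?_
          simp [v', i.2, A']
        rw [e1, ← Finset.sum_subtype (p := fun i => i ∉ Z) (Finset.univ.filter fun i => i ∉ Z)
          (by simp) (fun i => v' i * (A i j : ℝ))]
        change ∑ i, v' i * (A i j : ℝ) = _
        refine (Finset.sum_subset (Finset.subset_univ _) fun i _ hi => ?_).symm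
        have hiZ : i ∈ Z := by simpa using hi
        simp [v', hiZ]
      funext i
      have := congrFun h1 i.1
      simpa [v', i.2] using this
    obtain ⟨b, hb⟩ := exists_mulVec_single A' hA' ⟨i, hi⟩
    have hb' : ∀ i' (h : i' ∉ Z), Matrix.mulVec (A.map ((↑) : ℤ → ℝ)) b i' =
        (Pi.single ⟨i, hi⟩ 1 : {i // i ∉ Z} → ℝ) ⟨i', h⟩ := fun i' h => congrFun hb ⟨i', h⟩
    obtain ⟨z, hz1, hz2⟩ := exists_int_solution
      (A.submatrix (fun i' : {i' // i' ∉ Z ∧ i' ≠ i} => i'.1) id)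
      (S := {b | Matrix.mulVec (A.map ((↑) : ℤ → ℝ)) b i ≠ 0})
      (isOpen_ne_fun (by unfold Matrix.mulVec dotProduct; fun_prop) continuous_const)
      (fun x hx r hr => by
        change Matrix.mulVec _ (r • x) i ≠ 0
        rw [Matrix.mulVec_smul, Pi.smul_apply, smul_eq_mul]
        exact mul_ne_zero hr.ne' hx)
      (x := b) (by change Matrix.mulVec _ b i ≠ 0; rw [hb' i hi]; simp)
      (by
        funext i'
        have := hb' i'.1 i'.2.1
        rw [Pi.single_eq_of_ne (by simpa using i'.2.2)] at this
        exact this)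
    refine ⟨z, fun _ => ⟨?_, fun i' h1 h2 => congrFun hz1 ⟨i', h1, h2⟩⟩⟩
    intro h
    apply hz2
    rw [map_mulVec, h]; simp
  choose B hB using key
  exact ⟨B, hB⟩

/-- The integral certificates that decide group balancedness. -/
theorem certificate_alternatives (A : Matrix (Fin k) (Fin n) ℤ) :
    (∃ w : Fin k → ℤ, Matrix.vecMul w A = 0 ∧ (∃ i, 0 < w i) ∧ ∃ j, w j < 0) ∨
    (∃ B, KerCert A ∅ B) ∨
    (∃ v : Fin k → ℤ, (∀ j, 0 ≤ Matrix.vecMul v A j) ∧ ∃ j, 0 < Matrix.vecMul v A j) ∨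
    (∃ (w : Fin k → ℤ) (i₀ : Fin k) (B : Fin k → Fin n → ℤ) (μ : Fin n → ℤ),
      Matrix.vecMul w A = 0 ∧ (∀ i, 0 ≤ w i) ∧ 0 < w i₀ ∧ KerCert A {i₀} B ∧ (∀ j, 0 < μ j) ∧
      Matrix.mulVec A μ = 0) := by
  classical
  have htr : ∀ w : Fin k → ℤ, Matrix.mulVec A.transpose w = Matrix.vecMul w A :=
    fun w => Matrix.mulVec_transpose A w
  have htr' : ∀ w : Fin k → ℝ, Matrix.mulVec (A.transpose.map ((↑) : ℤ → ℝ)) w =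
      Matrix.vecMul w (A.map ((↑) : ℤ → ℝ)) :=
    fun w => Matrix.mulVec_transpose (A.map ((↑) : ℤ → ℝ)) w
  by_contra! hcon
  obtain ⟨hmix, htriv, hfar, hpos⟩ := hcon
  -- The absence of integral kernel vectors of mixed sign excludes real ones, by density.
  have rmix : ∀ w : Fin k → ℝ, Matrix.vecMul w (A.map ((↑) : ℤ → ℝ)) = 0 → ∀ i j, 0 < w i →
      0 ≤ w j := by
    intro w hw i j hi
    by_contra hj
    push Not at hj
    obtain ⟨z, hz, hz1, hz2⟩ := exists_int_solution A.transpose (S := {w | 0 < w i ∧ w j < 0})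
      ((isOpen_lt continuous_const (continuous_apply i)).inter
        (isOpen_lt (continuous_apply j) continuous_const))
      (fun x hx r hr => ⟨mul_pos hr hx.1, mul_neg_of_pos_of_neg hr hx.2⟩)
      (x := w) ⟨hi, hj⟩ (by rw [htr', hw])
    have hz1' : 0 < z i := Int.cast_pos.1 hz1
    have hz2' : z j < 0 := Int.cast_lt_zero.1 hz2
    exact absurd (hmix z (by rw [← htr, hz]) ⟨i, hz1'⟩ j) (not_le.2 hz2')
  have hne : ∃ w : Fin k → ℝ, Matrix.vecMul w (A.map ((↑) : ℤ → ℝ)) = 0 ∧ w ≠ 0 := by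
    by_contra! h
    obtain ⟨B, hB⟩ := exists_kerCert A ∅ fun v hv _ => h v hv
    exact htriv B hB
  obtain ⟨w, i₀, hw, hwi⟩ : ∃ (w : Fin k → ℝ) (i₀ : Fin k),
      Matrix.vecMul w (A.map ((↑) : ℤ → ℝ)) = 0 ∧ 0 < w i₀ := by
    obtain ⟨w, hw, hw0⟩ := hne
    obtain ⟨i₀, hi⟩ := Function.ne_iff.1 hw0
    rcases lt_or_gt_of_ne hi with h | h
    · exact ⟨-w, i₀, by rw [Matrix.neg_vecMul, hw, neg_zero], by simpa using h⟩
    · exact ⟨w, i₀, hw, h⟩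
  have hker : ∀ v, Matrix.vecMul v (A.map ((↑) : ℤ → ℝ)) = 0 →
      (∀ i ∈ ({i₀} : Set (Fin k)), v i = 0) → v = 0 := by
    have hle : ∀ v, Matrix.vecMul v (A.map ((↑) : ℤ → ℝ)) = 0 → v i₀ = 0 → ∀ i, v i ≤ 0 := by
      intro v hv h0 i
      by_contra hi
      push Not at hi
      -- Chosen so that `w - t • v` has entry -1 at `i` while keeping its positive entry at `i₀`: a
      -- mixed sign.
      let t : ℝ := (w i + 1) / v i
      have h1 := rmix (w - t • v) (by rw [Matrix.sub_vecMul, Matrix.smul_vecMul, hw, hv]; simp) i₀ i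
        (by simpa [h0] using hwi)
      have h2 : t * v i = w i + 1 := div_mul_cancel₀ _ hi.ne'
      simp only [Pi.sub_apply, Pi.smul_apply, smul_eq_mul, h2] at h1
      linarith
    intro v hv h0
    have h0 := h0 i₀ rfl
    funext i
    refine le_antisymm (hle v hv h0 i) ?_
    have := hle (-v) (by rw [Matrix.neg_vecMul, hv, neg_zero]) (by simpa using h0) i
    simpa using this
  obtain ⟨B, hB⟩ := exists_kerCert A {i₀} hker
  obtain ⟨μ, hμ, hμ0⟩ : ∃ μ : Fin n → ℤ, (∀ j, 0 < μ j) ∧ Matrix.mulVec A μ = 0 := by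
    rcases exists_pos_ker_or (A.map ((↑) : ℤ → ℝ)) with ⟨μ, h1, h2⟩ | ⟨v, h1, j, hj⟩
    · obtain ⟨z, hz, hz'⟩ := exists_int_solution A (S := {x : Fin n → ℝ | ∀ j, 0 < x j})
        (by
          rw [Set.ofPred_forall]
          exact isOpen_iInter_of_finite fun j => isOpen_lt continuous_const (continuous_apply j))
        (fun x hx r hr j => mul_pos hr (hx j)) (x := μ) h1 h2
      exact ⟨z, fun j => Int.cast_pos.1 (hz' j), hz⟩
    -- An integral `z` with the same sign pattern as `v`: zero entries of vA are kept by equations,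
    -- positive ones by openness.
    · obtain ⟨z, hz, hz'⟩ := exists_int_solution
        (A.transpose.submatrix
          (fun j : {j // Matrix.vecMul v (A.map ((↑) : ℤ → ℝ)) j = 0} => j.1) id)
        (S := {x : Fin k → ℝ | ∀ j, 0 < Matrix.vecMul v (A.map ((↑) : ℤ → ℝ)) j →
          0 < Matrix.vecMul x (A.map ((↑) : ℤ → ℝ)) j})
        (by
          simp only [Set.ofPred_forall]
          refine isOpen_iInter_of_finite fun j => isOpen_iInter_of_finite fun _ =>
            isOpen_lt continuous_const ?_
          unfold Matrix.vecMul dotProduct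
          fun_prop)
        (fun x hx r hr j hj => by
          rw [Matrix.smul_vecMul]
          exact mul_pos hr (hx j hj))
        (x := v) (fun j hj => hj) (by
          funext j
          have := congrFun (htr' v) j.1
          rw [j.2] at this
          exact this)
      have hz0 : ∀ j, Matrix.vecMul v (A.map ((↑) : ℤ → ℝ)) j = 0 → Matrix.vecMul z A j = 0 := by
        intro j hj
        rw [← htr]
        exact congrFun hz ⟨j, hj⟩
      have hz1 : ∀ j, 0 < Matrix.vecMul v (A.map ((↑) : ℤ → ℝ)) j → 0 < Matrix.vecMul z A j := by
        intro j hj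
        have := hz' j hj
        rw [map_vecMul] at this
        exact_mod_cast this
      refine absurd (hz1 j hj) (not_lt.2 (hfar z (fun j => ?_) j))
      rcases (h1 j).eq_or_lt with h | h
      · exact (hz0 j h.symm).ge
      · exact (hz1 j h).le
  obtain ⟨z, hz, hz1⟩ := exists_int_solution A.transpose (S := {w | 0 < w i₀})
    (isOpen_lt continuous_const (continuous_apply i₀))
    (fun x hx r hr => mul_pos hr hx) (x := w) hwi (by rw [htr', hw])
  have hz1' : 0 < z i₀ := Int.cast_pos.1 (show (0 : ℝ) < z i₀ from hz1)
  have hz' : Matrix.vecMul z A = 0 := by rw [← htr, hz]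
  exact hpos z i₀ B μ hz' (hmix z hz' ⟨i₀, hz1'⟩) hz1' hB hμ hμ0

end Rational

open Encodable Denumerable

/-! ### Primitive recursive integer arithmetic -/

section PrimrecInt

variable {α : Type} [Primcodable α]

theorem encode_natCast_int (m : ℕ) : encode (m : ℤ) = 2 * m := rfl

theorem encode_negSucc_int (m : ℕ) : encode (Int.negSucc m) = 2 * m + 1 := rfl

theorem ofNat_int_even (m : ℕ) : ofNat ℤ (2 * m) = m := by
  rw [← encode_natCast_int, ofNat_encode]

theorem ofNat_int_odd (m : ℕ) : ofNat ℤ (2 * m + 1) = Int.negSucc m := by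
  rw [← encode_negSucc_int, ofNat_encode]

/-- Sums, differences and products of integers reduce to this case through positive and negative
parts. The code of m ≥ 0 is 2m, that of -m - 1 is 2m + 1. -/
theorem primrec_int_natSub {f g : α → ℕ} (hf : Primrec f) (hg : Primrec g) :
    Primrec fun a => (f a : ℤ) - g a := by
  have h : Primrec fun a => ofNat ℤ
      (if g a ≤ f a then 2 * (f a - g a) else 2 * (g a - f a - 1) + 1) :=
    (Primrec.ofNat ℤ).comp (Primrec.ite (Primrec.nat_le.comp hg hf)
      (Primrec.nat_double.comp (Primrec.nat_sub.comp hf hg))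
      (Primrec.nat_double_succ.comp
        (Primrec.nat_sub.comp (Primrec.nat_sub.comp hg hf) (Primrec.const 1))))
  refine h.of_eq fun a => ?_
  split_ifs with hle
  · rw [ofNat_int_even]; omega
  · rw [ofNat_int_odd, Int.negSucc_eq]; omega

theorem primrec_int_toNat {f : α → ℤ} (hf : Primrec f) : Primrec fun a => (f a).toNat := by
  have h : Primrec fun a => if encode (f a) % 2 = 0 then encode (f a) / 2 else 0 :=
    Primrec.ite (Primrec.eq.comp (Primrec.nat_mod.comp (Primrec.encode.comp hf) (Primrec.const 2))
      (Primrec.const 0)) (Primrec.nat_div.comp (Primrec.encode.comp hf) (Primrec.const 2))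
      (Primrec.const 0)
  refine h.of_eq fun a => ?_
  generalize f a = z
  cases z with
  | ofNat m => rw [Int.ofNat_eq_natCast, encode_natCast_int]; simp
  | negSucc m => rw [encode_negSucc_int]; simp

theorem primrec_int_toNat_neg {f : α → ℤ} (hf : Primrec f) : Primrec fun a => (-f a).toNat := by
  have h : Primrec fun a => if encode (f a) % 2 = 0 then 0 else encode (f a) / 2 + 1 :=
    Primrec.ite (Primrec.eq.comp (Primrec.nat_mod.comp (Primrec.encode.comp hf) (Primrec.const 2))
      (Primrec.const 0)) (Primrec.const 0)
      (Primrec.succ.comp (Primrec.nat_div.comp (Primrec.encode.comp hf) (Primrec.const 2)))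
  refine h.of_eq fun a => ?_
  generalize f a = z
  cases z with
  | ofNat m => rw [Int.ofNat_eq_natCast, encode_natCast_int]; simp
  | negSucc m => rw [encode_negSucc_int, Int.neg_negSucc]; simp; omega

theorem primrec_int_add {f g : α → ℤ} (hf : Primrec f) (hg : Primrec g) :
    Primrec fun a => f a + g a :=
  (primrec_int_natSub
    (Primrec.nat_add.comp (primrec_int_toNat hf) (primrec_int_toNat hg))
    (Primrec.nat_add.comp (primrec_int_toNat_neg hf) (primrec_int_toNat_neg hg))).of_eq
    fun a => by push_cast; omega

theorem primrec_int_sub {f g : α → ℤ} (hf : Primrec f) (hg : Primrec g) :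
    Primrec fun a => f a - g a :=
  (primrec_int_natSub
    (Primrec.nat_add.comp (primrec_int_toNat hf) (primrec_int_toNat_neg hg))
    (Primrec.nat_add.comp (primrec_int_toNat_neg hf) (primrec_int_toNat hg))).of_eq
    fun a => by push_cast; omega

theorem primrec_int_mul {f g : α → ℤ} (hf : Primrec f) (hg : Primrec g) :
    Primrec fun a => f a * g a := by
  have f1 := primrec_int_toNat hf
  have f2 := primrec_int_toNat_neg hf
  have g1 := primrec_int_toNat hg
  have g2 := primrec_int_toNat_neg hg
  refine (primrec_int_natSub
    (Primrec.nat_add.comp (Primrec.nat_mul.comp f1 g1) (Primrec.nat_mul.comp f2 g2))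
    (Primrec.nat_add.comp (Primrec.nat_mul.comp f1 g2) (Primrec.nat_mul.comp f2 g1))).of_eq
    fun a => ?_
  have h1 := Int.toNat_sub_toNat_neg (f a)
  have h2 := Int.toNat_sub_toNat_neg (g a)
  conv_rhs => rw [← h1, ← h2]
  push_cast
  ring

theorem primrecPred_int_pos {f : α → ℤ} (hf : Primrec f) : PrimrecPred fun a => 0 < f a :=
  (Primrec.nat_lt.comp (Primrec.const 0) (primrec_int_toNat hf)).of_eq fun a => by omega

theorem primrecPred_int_neg {f : α → ℤ} (hf : Primrec f) : PrimrecPred fun a => f a < 0 :=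
  (Primrec.nat_lt.comp (Primrec.const 0) (primrec_int_toNat_neg hf)).of_eq fun a => by omega

theorem primrecPred_int_nonneg {f : α → ℤ} (hf : Primrec f) : PrimrecPred fun a => 0 ≤ f a :=
  (primrecPred_int_neg hf).not.of_eq fun a => by omega

theorem primrecPred_int_zero {f : α → ℤ} (hf : Primrec f) : PrimrecPred fun a => f a = 0 :=
  Primrec.eq.comp hf (Primrec.const 0)

theorem primrec_two_pow {f : α → ℕ} (hf : Primrec f) : Primrec fun a => 2 ^ f a :=
  (Primrec₂.unpaired'.1 Nat.Primrec.pow).comp (Primrec.const 2) hf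

theorem primrec_sum {f : α → ℕ} {g : α → ℕ → ℤ} (hf : Primrec f)
    (hg : Primrec fun p : α × ℕ => g p.1 p.2) :
    Primrec fun a => ∑ t ∈ Finset.range (f a), g a t := by
  have h : Primrec fun a => Nat.rec (motive := fun _ => ℤ) (0 : ℤ)
      (fun t IH => IH + g a t) (f a) :=
    Primrec.nat_rec' (h := fun a (p : ℕ × ℤ) => p.2 + g a p.1) hf (Primrec.const 0)
      (primrec_int_add (Primrec.snd.comp Primrec.snd)
        (hg.comp (Primrec.pair Primrec.fst (Primrec.fst.comp Primrec.snd))))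
  refine h.of_eq fun a => ?_
  generalize f a = N
  induction N with
  | zero => simp
  | succ N ih => rw [Finset.sum_range_succ, ← ih]

theorem primrecPred_forall {f : α → ℕ} {R : α → ℕ → Prop} (hf : Primrec f)
    (hR : PrimrecPred fun p : α × ℕ => R p.1 p.2) : PrimrecPred fun a => ∀ x < f a, R a x := by
  have h : PrimrecRel fun (x : ℕ) (a : α) => R a x :=
    hR.comp (Primrec.pair Primrec.snd Primrec.fst)
  exact (h.forall_mem_list.comp (Primrec.list_range.comp hf) Primrec.id).of_eq fun a => by simp

theorem primrecPred_exists {f : α → ℕ} {R : α → ℕ → Prop} (hf : Primrec f)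
    (hR : PrimrecPred fun p : α × ℕ => R p.1 p.2) : PrimrecPred fun a => ∃ x < f a, R a x := by
  have h : PrimrecRel fun (x : ℕ) (a : α) => R a x :=
    hR.comp (Primrec.pair Primrec.snd Primrec.fst)
  exact (h.exists_mem_list.comp (Primrec.list_range.comp hf) Primrec.id).of_eq fun a => by simp

end PrimrecInt

/-! ### Many-one reductions as Turing reductions -/

section ManyOne

/-- A computable many-one reduction is a Turing reduction. -/
theorem turingReducible_charFun {I J : Type} [Primcodable I] [Primcodable J] {P : I → Prop}
    {Q : J → Prop} {r : I → J} (hr : Computable r) {y₀ : J} (hy₀ : ¬ Q y₀)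
    (h : ∀ x, P x ↔ Q (r x)) : TuringReducible (charFun P) (charFun Q) := by
  -- Numbers that code no instance go to the negative instance `y₀`, matching the value 0 of
  -- `charFun` there.
  let g : ℕ → ℕ := fun m => ((decode m : Option I).map fun x => encode (r x)).getD (encode y₀)
  have hg : Computable g :=
    Computable.option_getD (Computable.option_map Computable.decode
      ((Computable.encode.comp hr).comp Computable.snd).to₂) (Computable.const _)
  have h1 : RecursiveIn {charFun Q} fun m => Part.some (g m) >>= charFun Q :=
    RecursiveIn.iff_nat.2 (Nat.RecursiveIn.comp (Nat.RecursiveIn.oracle _ rfl)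
      (RecursiveIn.iff_nat.1 hg.computableIn))
  refine h1.of_eq fun m => ?_
  refine (Part.bind_some (g m) (charFun Q)).trans ?_
  have key : (∃ y : J, decode (g m) = some y ∧ Q y) ↔ ∃ x : I, decode m = some x ∧ P x := by
    simp only [g]
    cases hm : (decode m : Option I) with
    | none => simpa using hy₀
    | some x => simp [h x]
  unfold charFun
  congr! 2

end ManyOne

/-! ### Subsets as binary numbers -/

section Coding

variable {n : ℕ}

/-- The number whose binary digits are the indicator of `α`. -/
def code (α : Finset (Fin n)) : ℕ := ∑ i ∈ α, 2 ^ (i : ℕ)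

theorem testBit_code (α : Finset (Fin n)) (j : Fin n) : (code α).testBit j ↔ j ∈ α := by
  have h1 : code α = ∑ i ∈ α.map Fin.valEmbedding, 2 ^ i := by simp [code]
  have h2 := Finset.toFinset_bitIndices_sum_two_pow (α.map Fin.valEmbedding)
  rw [← h1] at h2
  rw [← Nat.mem_bitIndices, ← List.mem_toFinset, h2]
  simp [← Fin.ext_iff]

theorem code_injective : Function.Injective (code : Finset (Fin n) → ℕ) := by
  intro α β h
  ext j
  rw [← testBit_code, h, testBit_code]

theorem code_univ : code (Finset.univ : Finset (Fin n)) + 1 = 2 ^ n := by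
  unfold code
  rw [← Finset.sum_range (fun i => 2 ^ i)]
  have := Nat.geomSum_eq (le_refl 2) n
  have := Nat.one_le_two_pow (n := n)
  simp_all

/-- Together with `code_univ`, this lets `balancedList` recognise by arithmetic the two subsets
occurring in h(j | rest). -/
theorem code_erase (j : Fin n) : code (Finset.univ.erase j) + 2 ^ (j : ℕ) = code (Finset.univ : Finset (Fin n)) :=
  Finset.sum_erase_add _ _ (Finset.mem_univ j)

theorem code_lt (α : Finset (Fin n)) : code α < 2 ^ n := by
  rw [← code_univ]
  exact Nat.lt_succ_of_le (Finset.sum_le_sum_of_subset (Finset.subset_univ α))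

theorem sum_code (f : ℕ → ℤ) : ∑ α : Finset (Fin n), f (code α) = ∑ t ∈ Finset.range (2 ^ n), f t := by
  have h : Finset.univ.image (code : Finset (Fin n) → ℕ) = Finset.range (2 ^ n) := by
    refine Finset.eq_of_subset_of_card_le (fun t ht => ?_) ?_
    · obtain ⟨α, -, rfl⟩ := Finset.mem_image.1 ht
      exact Finset.mem_range.2 (code_lt α)
    · rw [Finset.card_image_of_injective _ code_injective]
      simp
  rw [← h, Finset.sum_image fun _ _ _ _ e => code_injective e]

/-- The residual weight at `j` of the vector with coordinates `l`. -/
def wt (n : ℕ) (l : List ℤ) (j : ℕ) : ℤ :=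
  ∑ t ∈ Finset.range (2 ^ n), if t / 2 ^ j % 2 = 1 then l.getD t 0 else 0

theorem dot_coeffs_basicModular (l : List ℤ) (j : Fin n) :
    dot (coeffs n l) (basicModular j) = wt n l j := by
  unfold wt
  rw [← sum_code]
  push_cast
  unfold dot
  refine Finset.sum_congr rfl fun α _ => ?_
  have h : code α / 2 ^ (j : ℕ) % 2 = 1 ↔ j ∈ α := by
    rw [← testBit_code, Nat.testBit_eq_decide_div_mod_eq]; simp
  simp only [h, basicModular, coeffs]
  split_ifs
  · rw [mul_one]; rfl
  · simp

theorem coeffs_map_range (g : ℕ → ℤ) (α : Finset (Fin n)) :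
    coeffs n ((List.range (2 ^ n)).map g) α = g (code α) := by
  unfold coeffs
  change (((List.map g (List.range (2 ^ n))).getD (code α) 0 : ℤ) : ℝ) = _
  rw [List.getD_eq_getElem _ _ (by simpa using code_lt α)]
  simp

/-- The integral coordinates of the balanced version of an inequality. -/
def balancedList (n : ℕ) (l : List ℤ) : List ℤ :=
  (List.range (2 ^ n)).map fun t => l.getD t 0 - ∑ j ∈ Finset.range n, wt n l j *
    ((if t + 1 = 2 ^ n then 1 else 0) - if t + 2 ^ j + 1 = 2 ^ n then 1 else 0)

theorem coeffs_balancedList (l : List ℤ) : coeffs n (balancedList n l) = balanced (coeffs n l) := by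
  funext α
  unfold balancedList balanced
  rw [coeffs_map_range, Finset.sum_range (fun j => wt n l j *
    ((if code α + 1 = 2 ^ n then 1 else 0) - if code α + 2 ^ j + 1 = 2 ^ n then 1 else 0))]
  push_cast
  simp only [Pi.sub_apply, Finset.sum_apply, Pi.smul_apply, smul_eq_mul, dot_coeffs_basicModular]
  congr 1
  refine Finset.sum_congr rfl fun j _ => ?_
  have h1 : code α + 1 = 2 ^ n ↔ α = Finset.univ := by
    rw [← code_univ (n := n), add_left_inj, code_injective.eq_iff]
  have h2 : code α + 2 ^ (j : ℕ) + 1 = 2 ^ n ↔ α = Finset.univ.erase j := by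
    rw [← code_univ (n := n), add_left_inj, ← code_erase j, add_left_inj, code_injective.eq_iff]
  simp only [h1, h2, privateInfo, Pi.sub_apply, Pi.single_apply]

end Coding

/-! ### The reduction of IIP to group-balanced MaxIIP -/

section Reduce

open Classical in
/-- The reduction of arbitrary inequalities to balanced ones. -/
noncomputable def balanceInstance (x : ℕ × List ℤ) : ℕ × List (List ℤ) :=
  if x.2.length = 2 ^ x.1 ∧ ∀ j < x.1, 0 ≤ wt x.1 x.2 j then (x.1, [balancedList x.1 x.2])
  else (0, [])

theorem iip_iff_balanceInstance (x : ℕ × List ℤ) :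
    IIP entropicRegion x ↔ GroupBalancedMaxIIP entropicRegion (balanceInstance x) := by
  obtain ⟨n, l⟩ := x
  have hw : (∀ j < n, 0 ≤ wt n l j) ↔ ∀ j : Fin n, 0 ≤ dot (coeffs n l) (basicModular j) := by
    simp only [dot_coeffs_basicModular, Int.cast_nonneg_iff]
    exact ⟨fun h j => h j j.2, fun h j hj => h ⟨j, hj⟩⟩
  unfold IIP balanceInstance
  simp only
  rw [valid_iff_balanced, ← hw, ← and_assoc]
  split_ifs with h
  · rw [and_iff_right h]
    unfold GroupBalancedMaxIIP
    have hc : ∀ j : Fin [balancedList n l].length,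
        coeffs n ([balancedList n l].get j) = balanced (coeffs n l) := by
      intro j
      have : [balancedList n l].get j = balancedList n l := by
        have : j = 0 := Subsingleton.elim (α := Fin 1) _ _
        rw [this]; rfl
      rw [this, coeffs_balancedList]
    simp only [hc]
    constructor
    · intro hv
      refine ⟨fun l' hl' => ?_, isGroupBalanced_single (fun j => dot_balanced_basicModular _ j),
        (maxValid_single _ _).2 hv⟩
      rw [List.mem_singleton.1 hl']
      simp [balancedList]
    · exact fun hv => (maxValid_single _ _).1 hv.2.2
  · simp only [h, false_and, false_iff]
    intro hg
    have := hg.2.1.1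
    simp at this

/-- A vector for n = 0 has one coordinate, not none. -/
theorem not_iip_nil (S : (n : ℕ) → Set (SetVec n)) : ¬ IIP S (0, []) := by
  simp [IIP]

/-- For the empty family, the rank condition would read rank + 1 = 0. -/
theorem not_groupBalancedMaxIIP_nil (S : (n : ℕ) → Set (SetVec n)) :
    ¬ GroupBalancedMaxIIP S (0, []) := by
  intro hg
  have := hg.2.1.1
  simp at this

variable {α : Type} [Primcodable α]

theorem primrec_wt {n : α → ℕ} {l : α → List ℤ} {j : α → ℕ} (hn : Primrec n) (hl : Primrec l)
    (hj : Primrec j) : Primrec fun a => wt (n a) (l a) (j a) :=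
  primrec_sum (primrec_two_pow hn) (Primrec.ite
    (Primrec.eq.comp (Primrec.nat_mod.comp (Primrec.nat_div.comp Primrec.snd
      (primrec_two_pow (hj.comp Primrec.fst))) (Primrec.const 2)) (Primrec.const 1))
    ((Primrec.list_getD 0).comp (hl.comp Primrec.fst) Primrec.snd) (Primrec.const 0))

theorem primrec_balancedList {n : α → ℕ} {l : α → List ℤ} (hn : Primrec n) (hl : Primrec l) :
    Primrec fun a => balancedList (n a) (l a) := by
  refine Primrec.list_map (Primrec.list_range.comp (primrec_two_pow hn)) ?_
  unfold Primrec₂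
  refine primrec_int_sub ((Primrec.list_getD 0).comp (hl.comp Primrec.fst) Primrec.snd) ?_
  have hn' : Primrec fun p : (α × ℕ) × ℕ => n p.1.1 := hn.comp (Primrec.fst.comp Primrec.fst)
  have hl' : Primrec fun p : (α × ℕ) × ℕ => l p.1.1 := hl.comp (Primrec.fst.comp Primrec.fst)
  have ht : Primrec fun p : (α × ℕ) × ℕ => p.1.2 := Primrec.snd.comp Primrec.fst
  have hj : Primrec fun p : (α × ℕ) × ℕ => p.2 := Primrec.snd
  exact primrec_sum (hn.comp Primrec.fst) (primrec_int_mul (primrec_wt hn' hl' hj)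
    (primrec_int_sub
      (Primrec.ite (Primrec.eq.comp (Primrec.succ.comp ht) (primrec_two_pow hn'))
        (Primrec.const 1) (Primrec.const 0))
      (Primrec.ite (Primrec.eq.comp (Primrec.succ.comp (Primrec.nat_add.comp ht
        (primrec_two_pow hj))) (primrec_two_pow hn')) (Primrec.const 1) (Primrec.const 0))))

theorem primrec_balanceInstance : Primrec balanceInstance := by
  classical
  have h : PrimrecPred fun x : ℕ × List ℤ =>
      x.2.length = 2 ^ x.1 ∧ ∀ j < x.1, 0 ≤ wt x.1 x.2 j :=
    (Primrec.eq.comp (Primrec.list_length.comp Primrec.snd) (primrec_two_pow Primrec.fst)).and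
      (primrecPred_forall Primrec.fst (primrecPred_int_nonneg
        (primrec_wt (Primrec.fst.comp Primrec.fst) (Primrec.snd.comp Primrec.fst) Primrec.snd)))
  refine (Primrec.ite h (Primrec.pair Primrec.fst (Primrec.list_cons.comp
    (primrec_balancedList Primrec.fst Primrec.snd) (Primrec.const [])))
    (Primrec.const (0, []))).of_eq fun x => ?_
  unfold balanceInstance
  congr!

theorem turingReducible_iip_groupBalancedMaxIIP : TuringReducible
    (charFun (IIP entropicRegion)) (charFun (GroupBalancedMaxIIP entropicRegion)) :=
  turingReducible_charFun primrec_balanceInstance.to_comp (not_groupBalancedMaxIIP_nil _)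
    iip_iff_balanceInstance

end Reduce

/-! ### Certificates for instances of MaxIIP -/

section Certificates

/-- The entry in row `i` and column `t`. -/
def entry (L : List (List ℤ)) (i t : ℕ) : ℤ := (L.getD i []).getD t 0

/-- The residual weight at `j` of the `i`-th vector of an instance. -/
def instWt (x : ℕ × List (List ℤ)) (i j : ℕ) : ℤ := wt x.1 (x.2.getD i []) j

/-- A certificate: a row index with a list of rows, the first of which are a vector on the rows and
a vector on the columns of the weight matrix, and the others a matrix. -/
abbrev Cert : Type := ℕ × List (List ℤ)

/-- The first vector of a certificate times the weight matrix. -/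
def rowProd (x : ℕ × List (List ℤ)) (c : Cert) (j : ℕ) : ℤ :=
  ∑ i ∈ Finset.range x.2.length, entry c.2 0 i * instWt x i j

/-- The weight matrix times the `m`-th row of a certificate. -/
def colProd (x : ℕ × List (List ℤ)) (c : Cert) (m i : ℕ) : ℤ :=
  ∑ j ∈ Finset.range x.1, instWt x i j * entry c.2 m j

/-- Row `i + 2` of the certificate serves as the vector B_i of `KerCert`. The exceptional set is the
row `c.1`, and is empty when `c.1` is out of range. -/
def KerCheck (x : ℕ × List (List ℤ)) (c : Cert) : Prop :=
  ∀ i < x.2.length, i = c.1 ∨ (¬ colProd x c (i + 2) i = 0 ∧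
    ∀ i' < x.2.length, i' = c.1 ∨ i' = i ∨ colProd x c (i + 2) i' = 0)

def LengthCheck (x : ℕ × List (List ℤ)) : Prop :=
  ∀ i < x.2.length, (x.2.getD i []).length = 2 ^ x.1

/-- The certificates that an instance is negative. -/
def NegCheck (x : ℕ × List (List ℤ)) (c : Cert) : Prop :=
  ¬ LengthCheck x ∨
  ((∀ j < x.1, rowProd x c j = 0) ∧ (∃ i < x.2.length, 0 < entry c.2 0 i) ∧
    ∃ i < x.2.length, entry c.2 0 i < 0) ∨
  (x.2.length ≤ c.1 ∧ KerCheck x c) ∨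
  ((∀ j < x.1, 0 ≤ rowProd x c j) ∧ ∃ j < x.1, 0 < rowProd x c j)

/-- The certificates that a max-inequality is group balanced and equivalent to the inequality
`query`. -/
def PosCheck (x : ℕ × List (List ℤ)) (c : Cert) : Prop :=
  LengthCheck x ∧ (∀ j < x.1, rowProd x c j = 0) ∧ (∀ i < x.2.length, 0 ≤ entry c.2 0 i) ∧
  c.1 < x.2.length ∧ 0 < entry c.2 0 c.1 ∧ KerCheck x c ∧ (∀ j < x.1, 0 < entry c.2 1 j) ∧
  ∀ i < x.2.length, colProd x c 1 i = 0

/-- The combination of the vectors of an instance by the first vector of a certificate. -/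
def query (x : ℕ × List (List ℤ)) (c : Cert) : ℕ × List ℤ :=
  (x.1, (List.range (2 ^ x.1)).map fun t =>
    ∑ i ∈ Finset.range x.2.length, entry c.2 0 i * entry x.2 i t)

/-- The integral weight matrix of an instance. -/
def instMatrix (x : ℕ × List (List ℤ)) : Matrix (Fin x.2.length) (Fin x.1) ℤ :=
  Matrix.of fun i j => instWt x i j

theorem weights_instance (x : ℕ × List (List ℤ)) :
    weights (fun j : Fin x.2.length => coeffs x.1 (x.2.get j)) =
      (instMatrix x).map ((↑) : ℤ → ℝ) := by
  ext i j
  simp only [weights, Matrix.of_apply, dot_coeffs_basicModular, Matrix.map_apply, instMatrix, instWt]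
  rw [List.getD_eq_getElem _ _ i.2]
  rfl

theorem lengthCheck_iff (x : ℕ × List (List ℤ)) :
    LengthCheck x ↔ ∀ l ∈ x.2, l.length = 2 ^ x.1 := by
  unfold LengthCheck
  constructor
  · intro h l hl
    obtain ⟨i, hi, rfl⟩ := List.getElem_of_mem hl
    have := h i hi
    rwa [List.getD_eq_getElem _ _ hi] at this
  · intro h i hi
    rw [List.getD_eq_getElem _ _ hi]
    exact h _ (List.getElem_mem hi)

variable {x : ℕ × List (List ℤ)} {c : Cert}

theorem rowProd_eq {w : Fin x.2.length → ℤ} (hw : ∀ i : Fin x.2.length, entry c.2 0 i = w i)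
    (j : Fin x.1) : rowProd x c j = Matrix.vecMul w (instMatrix x) j := by
  unfold rowProd
  rw [Finset.sum_range (fun i => entry c.2 0 i * instWt x i j)]
  simp only [hw]
  rfl

theorem colProd_eq {m : ℕ} {b : Fin x.1 → ℤ} (hb : ∀ j : Fin x.1, entry c.2 m j = b j)
    (i : Fin x.2.length) : colProd x c m i = Matrix.mulVec (instMatrix x) b i := by
  unfold colProd
  rw [Finset.sum_range (fun j => instWt x i j * entry c.2 m j)]
  simp only [hb]
  rfl

theorem kerCheck_iff {B : Fin x.2.length → Fin x.1 → ℤ}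
    (hB : ∀ (i : Fin x.2.length) (j : Fin x.1), entry c.2 (i + 2) j = B i j) :
    KerCheck x c ↔ KerCert (instMatrix x) {i | (i : ℕ) = c.1} B := by
  have h : ∀ i i' : Fin x.2.length, colProd x c (i + 2) i' =
      Matrix.mulVec (instMatrix x) (B i) i' := fun i i' => colProd_eq (hB i) i'
  unfold KerCheck KerCert
  constructor
  · intro hk i hi
    obtain ⟨h1, h2⟩ := (hk i i.2).resolve_left hi
    rw [h] at h1
    refine ⟨h1, fun i' hi' hne => ?_⟩
    rw [← h]
    exact ((h2 i' i'.2).resolve_left hi').resolve_left fun e => hne (Fin.ext e)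
  · intro hk i hi
    by_cases hie : i = c.1
    · exact Or.inl hie
    obtain ⟨h1, h2⟩ := hk ⟨i, hi⟩ hie
    rw [← h] at h1
    refine Or.inr ⟨h1, fun i' hi' => ?_⟩
    by_cases hie' : i' = c.1
    · exact Or.inl hie'
    by_cases hii : i' = i
    · exact Or.inr (Or.inl hii)
    · have := h2 ⟨i', hi'⟩ hie' (fun e => hii (congrArg Fin.val e))
      rw [← h] at this
      exact Or.inr (Or.inr this)

theorem vecMul_cast_eq_zero {w : Fin x.2.length → ℤ} (h : Matrix.vecMul w (instMatrix x) = 0) :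
    Matrix.vecMul (fun i => (w i : ℝ))
      (weights (fun j : Fin x.2.length => coeffs x.1 (x.2.get j))) = 0 := by
  funext j
  rw [weights_instance, map_vecMul, h]
  simp

/-- The four kinds of certificate refute, in turn, the format, the validity (a left kernel vector of
mixed sign), the rank condition (a trivial left kernel), and the positive modular function (a
nonzero combination vA ≥ 0). -/
theorem NegCheck.not_groupBalancedMaxIIP (h : NegCheck x c) :
    ¬ GroupBalancedMaxIIP entropicRegion x := by
  rintro ⟨hlen, hgb, hval⟩
  let w : Fin x.2.length → ℤ := fun i => entry c.2 0 i
  have hrow : ∀ j : Fin x.1, rowProd x c j = Matrix.vecMul w (instMatrix x) j :=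
    rowProd_eq fun i => rfl
  rcases h with h | ⟨h0, ⟨i, hi, hi'⟩, j, hj, hj'⟩ | ⟨hk, hker⟩ | ⟨h0, j, hj, hj'⟩
  · exact h ((lengthCheck_iff x).2 hlen)
  · refine hgb.not_maxValid (vecMul_cast_eq_zero (w := w) ?_) (i := ⟨i, hi⟩) (j := ⟨j, hj⟩)
      (Int.cast_pos.2 hi') (Int.cast_lt_zero.2 hj') hval
    funext j
    rw [← hrow]
    exact h0 j j.2
  · rw [kerCheck_iff (B := fun i j => entry c.2 (i + 2) j) fun _ _ => rfl] at hker
    obtain ⟨v, hv, hv0⟩ := hgb.exists_ker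
    rw [weights_instance] at hv
    refine hv0 (hker.eq_zero hv fun i hi => ?_)
    exact absurd (hi : (i : ℕ) = c.1) (i.2.trans_le hk).ne
  · have h1 := hgb.vecMul_eq_zero (v := fun i => (w i : ℝ)) (fun j => by
      rw [weights_instance, map_vecMul, ← hrow]
      exact Int.cast_nonneg (h0 j j.2))
    have h2 := congrFun h1 ⟨j, hj⟩
    rw [weights_instance, map_vecMul, ← hrow, Pi.zero_apply, Int.cast_eq_zero] at h2
    exact hj'.ne' h2

theorem PosCheck.groupBalancedMaxIIP_iff (h : PosCheck x c) :
    GroupBalancedMaxIIP entropicRegion x ↔ IIP entropicRegion (query x c) := by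
  obtain ⟨hlen, hw0, hwn, he, hwe, hker, hμ, hμ0⟩ := h
  let w : Fin x.2.length → ℤ := fun i => entry c.2 0 i
  have hrow : ∀ j : Fin x.1, rowProd x c j = Matrix.vecMul w (instMatrix x) j :=
    rowProd_eq fun i => rfl
  have hw : Matrix.vecMul w (instMatrix x) = 0 := by
    funext j
    rw [← hrow]
    exact hw0 j j.2
  rw [kerCheck_iff (B := fun i j => entry c.2 (i + 2) j) fun _ _ => rfl] at hker
  have hgb : IsGroupBalanced (fun j : Fin x.2.length => coeffs x.1 (x.2.get j)) := by
    refine isGroupBalanced_of (vecMul_cast_eq_zero hw) (i₀ := ⟨c.1, he⟩)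
      (Int.cast_ne_zero.2 hwe.ne') (fun v hv hv0 => ?_)
      (μ := fun j => (entry c.2 1 j : ℝ)) (fun j => Int.cast_pos.2 (hμ j j.2)) ?_
    · rw [weights_instance] at hv
      refine hker.eq_zero hv fun i hi => ?_
      have : i = ⟨c.1, he⟩ := Fin.ext hi
      rw [this, hv0]
    · funext i
      rw [weights_instance, map_mulVec, ← colProd_eq (c := c) (m := 1) fun _ => rfl, hμ0 i i.2]
      simp
  have hq : coeffs x.1 (query x c).2 =
      ∑ j : Fin x.2.length, (w j : ℝ) • coeffs x.1 (x.2.get j) := by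
    funext α
    unfold query
    rw [coeffs_map_range, Finset.sum_range (fun i => entry c.2 0 i * entry x.2 i (code α))]
    push_cast
    simp only [Finset.sum_apply, Pi.smul_apply, smul_eq_mul]
    refine Finset.sum_congr rfl fun i _ => ?_
    have : x.2.getD i [] = x.2.get i := List.getD_eq_getElem _ _ i.2
    unfold entry
    rw [this]
    rfl
  have hiff := hgb.maxValid_iff (w := fun i => (w i : ℝ)) (vecMul_cast_eq_zero hw)
    (fun h => (Int.cast_ne_zero.2 hwe.ne' : (w ⟨c.1, he⟩ : ℝ) ≠ 0) (congrFun h ⟨c.1, he⟩))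
    (fun j => Int.cast_nonneg (hwn j j.2))
  rw [← hq] at hiff
  have hql : (query x c).2.length = 2 ^ x.1 := by simp [query]
  constructor
  · rintro ⟨-, -, hv⟩
    exact ⟨hql, hiff.1 hv⟩
  · rintro ⟨-, hv⟩
    exact ⟨(lengthCheck_iff x).1 hlen, hgb, hiff.2 hv⟩

theorem getD_ofFn {β : Type} {m : ℕ} (f : Fin m → β) (d : β) (i : Fin m) :
    (List.ofFn f).getD i d = f i := by
  rw [List.getD_eq_getElem _ _ (by simp)]
  simp

theorem exists_check (x : ℕ × List (List ℤ)) : ∃ c, NegCheck x c ∨ PosCheck x c := by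
  by_cases hlen : LengthCheck x
  swap
  · exact ⟨(0, []), Or.inl (Or.inl hlen)⟩
  rcases certificate_alternatives (instMatrix x) with ⟨w, hw, ⟨i, hi⟩, j, hj⟩ | ⟨B, hB⟩ |
    ⟨v, hv, j, hj⟩ | ⟨w, i₀, B, μ, hw, hwn, hwi, hB, hμ, hμ0⟩
  · have he : ∀ i : Fin x.2.length, entry [List.ofFn w] 0 i = w i := fun i => getD_ofFn w 0 i
    refine ⟨(0, [List.ofFn w]), Or.inl (Or.inr (Or.inl ⟨fun j hj => ?_, ⟨i, i.2, ?_⟩, j, j.2, ?_⟩))⟩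
    · rw [rowProd_eq he ⟨j, hj⟩, hw]; rfl
    · rw [he]; exact hi
    · rw [he]; exact hj
  -- The row index is out of range, so no row is exempt; the two empty rows fill the unused places
  -- of the vectors w and μ.
  · refine ⟨(x.2.length, [] :: [] :: List.ofFn fun i => List.ofFn (B i)),
      Or.inl (Or.inr (Or.inr (Or.inl ⟨le_rfl, ?_⟩)))⟩
    rw [kerCheck_iff (B := B)]
    · have : {i : Fin x.2.length | (i : ℕ) = x.2.length} = ∅ := by
        ext i; simpa using i.2.ne
      rw [this]
      exact hB
    · intro i j
      change ((List.ofFn fun i => List.ofFn (B i)).getD i []).getD j 0 = _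
      rw [getD_ofFn, getD_ofFn]
  · have he : ∀ i : Fin x.2.length, entry [List.ofFn v] 0 i = v i := fun i => getD_ofFn v 0 i
    refine ⟨(0, [List.ofFn v]), Or.inl (Or.inr (Or.inr (Or.inr ⟨fun j hj => ?_, j, j.2, ?_⟩)))⟩
    · rw [rowProd_eq he ⟨j, hj⟩]; exact hv _
    · rw [rowProd_eq he]; exact hj
  · let C : List (List ℤ) := List.ofFn w :: List.ofFn μ :: List.ofFn fun i => List.ofFn (B i)
    have he : ∀ i : Fin x.2.length, entry C 0 i = w i := fun i => getD_ofFn w 0 i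
    have he1 : ∀ j : Fin x.1, entry C 1 j = μ j := fun j => getD_ofFn μ 0 j
    refine ⟨(i₀, C), Or.inr ⟨hlen, fun j hj => ?_, fun i hi => ?_, i₀.2, ?_, ?_, fun j hj => ?_,
      fun i hi => ?_⟩⟩
    · rw [rowProd_eq he ⟨j, hj⟩, hw]; rfl
    · rw [he ⟨i, hi⟩]; exact hwn _
    · rw [he]; exact hwi
    · rw [kerCheck_iff (B := B)]
      · have : {i : Fin x.2.length | (i : ℕ) = i₀} = {i₀} := by
          ext i; simp [Fin.ext_iff]
        rw [this]
        exact hB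
      · intro i j
        change ((List.ofFn fun i => List.ofFn (B i)).getD i []).getD j 0 = _
        rw [getD_ofFn, getD_ofFn]
    · rw [he1 ⟨j, hj⟩]; exact hμ _
    · rw [colProd_eq he1 ⟨i, hi⟩, hμ0]; rfl

end Certificates

/-! ### The reduction of group-balanced MaxIIP to IIP by certificate search -/

section Search

variable {α : Type} [Primcodable α]

theorem primrec_entry {L : α → List (List ℤ)} {i t : α → ℕ} (hL : Primrec L) (hi : Primrec i)
    (ht : Primrec t) : Primrec fun a => entry (L a) (i a) (t a) :=
  (Primrec.list_getD 0).comp ((Primrec.list_getD []).comp hL hi) ht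

variable {x : α → ℕ × List (List ℤ)} {c : α → Cert}

theorem primrec_instWt {i j : α → ℕ} (hx : Primrec x) (hi : Primrec i) (hj : Primrec j) :
    Primrec fun a => instWt (x a) (i a) (j a) :=
  primrec_wt (Primrec.fst.comp hx) ((Primrec.list_getD []).comp (Primrec.snd.comp hx) hi) hj

theorem primrec_rowProd {j : α → ℕ} (hx : Primrec x) (hc : Primrec c) (hj : Primrec j) :
    Primrec fun a => rowProd (x a) (c a) (j a) :=
  primrec_sum (Primrec.list_length.comp (Primrec.snd.comp hx)) (primrec_int_mul
    (primrec_entry (Primrec.snd.comp (hc.comp Primrec.fst)) (Primrec.const 0) Primrec.snd)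
    (primrec_instWt (hx.comp Primrec.fst) Primrec.snd (hj.comp Primrec.fst)))

theorem primrec_colProd {m i : α → ℕ} (hx : Primrec x) (hc : Primrec c) (hm : Primrec m)
    (hi : Primrec i) : Primrec fun a => colProd (x a) (c a) (m a) (i a) :=
  primrec_sum (Primrec.fst.comp hx) (primrec_int_mul
    (primrec_instWt (hx.comp Primrec.fst) (hi.comp Primrec.fst) Primrec.snd)
    (primrec_entry (Primrec.snd.comp (hc.comp Primrec.fst)) (hm.comp Primrec.fst) Primrec.snd))

theorem primrecPred_kerCheck (hx : Primrec x) (hc : Primrec c) :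
    PrimrecPred fun a => KerCheck (x a) (c a) := by
  have hk : Primrec fun a => (x a).2.length := Primrec.list_length.comp (Primrec.snd.comp hx)
  have hi : Primrec fun p : α × ℕ => p.2 + 2 :=
    Primrec.nat_add.comp Primrec.snd (Primrec.const 2)
  refine primrecPred_forall hk ?_
  refine (Primrec.eq.comp Primrec.snd (Primrec.fst.comp (hc.comp Primrec.fst))).or
    ((primrecPred_int_zero (primrec_colProd (hx.comp Primrec.fst) (hc.comp Primrec.fst) hi
      Primrec.snd)).not.and ?_)
  refine primrecPred_forall (hk.comp Primrec.fst) ?_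
  exact (Primrec.eq.comp Primrec.snd
    (Primrec.fst.comp (hc.comp (Primrec.fst.comp Primrec.fst)))).or
    ((Primrec.eq.comp Primrec.snd (Primrec.snd.comp Primrec.fst)).or
    (primrecPred_int_zero (primrec_colProd (hx.comp (Primrec.fst.comp Primrec.fst))
      (hc.comp (Primrec.fst.comp Primrec.fst)) (hi.comp Primrec.fst) Primrec.snd)))

theorem primrecPred_lengthCheck (hx : Primrec x) : PrimrecPred fun a => LengthCheck (x a) :=
  primrecPred_forall (Primrec.list_length.comp (Primrec.snd.comp hx))
    (Primrec.eq.comp (Primrec.list_length.comp ((Primrec.list_getD []).comp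
      (Primrec.snd.comp (hx.comp Primrec.fst)) Primrec.snd))
      (primrec_two_pow (Primrec.fst.comp (hx.comp Primrec.fst))))

theorem primrecPred_negCheck (hx : Primrec x) (hc : Primrec c) :
    PrimrecPred fun a => NegCheck (x a) (c a) := by
  have hn : Primrec fun a => (x a).1 := Primrec.fst.comp hx
  have hk : Primrec fun a => (x a).2.length := Primrec.list_length.comp (Primrec.snd.comp hx)
  have hrow : Primrec fun p : α × ℕ => rowProd (x p.1) (c p.1) p.2 :=
    primrec_rowProd (hx.comp Primrec.fst) (hc.comp Primrec.fst) Primrec.snd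
  have hw : Primrec fun p : α × ℕ => entry (c p.1).2 0 p.2 :=
    primrec_entry (Primrec.snd.comp (hc.comp Primrec.fst)) (Primrec.const 0) Primrec.snd
  exact (primrecPred_lengthCheck hx).not.or
    (((primrecPred_forall hn (primrecPred_int_zero hrow)).and
      ((primrecPred_exists hk (primrecPred_int_pos hw)).and
        (primrecPred_exists hk (primrecPred_int_neg hw)))).or
    (((Primrec.nat_le.comp hk (Primrec.fst.comp hc)).and (primrecPred_kerCheck hx hc)).or
    ((primrecPred_forall hn (primrecPred_int_nonneg hrow)).and
      (primrecPred_exists hn (primrecPred_int_pos hrow)))))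

theorem primrecPred_posCheck (hx : Primrec x) (hc : Primrec c) :
    PrimrecPred fun a => PosCheck (x a) (c a) := by
  have hn : Primrec fun a => (x a).1 := Primrec.fst.comp hx
  have hk : Primrec fun a => (x a).2.length := Primrec.list_length.comp (Primrec.snd.comp hx)
  have hx' : Primrec fun p : α × ℕ => x p.1 := hx.comp Primrec.fst
  have hc' : Primrec fun p : α × ℕ => c p.1 := hc.comp Primrec.fst
  have hrow : Primrec fun p : α × ℕ => rowProd (x p.1) (c p.1) p.2 :=
    primrec_rowProd hx' hc' Primrec.snd
  exact (primrecPred_lengthCheck hx).and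
    ((primrecPred_forall hn (primrecPred_int_zero hrow)).and
    ((primrecPred_forall hk (primrecPred_int_nonneg
      (primrec_entry (Primrec.snd.comp hc') (Primrec.const 0) Primrec.snd))).and
    ((Primrec.nat_lt.comp (Primrec.fst.comp hc) hk).and
    ((primrecPred_int_pos (primrec_entry (Primrec.snd.comp hc) (Primrec.const 0)
      (Primrec.fst.comp hc))).and
    ((primrecPred_kerCheck hx hc).and
    ((primrecPred_forall hn (primrecPred_int_pos
      (primrec_entry (Primrec.snd.comp hc') (Primrec.const 1) Primrec.snd))).and
    (primrecPred_forall hk (primrecPred_int_zero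
      (primrec_colProd hx' hc' (Primrec.const 1) Primrec.snd)))))))))

theorem primrec_query (hx : Primrec x) (hc : Primrec c) : Primrec fun a => query (x a) (c a) := by
  refine Primrec.pair (Primrec.fst.comp hx)
    (Primrec.list_map (Primrec.list_range.comp (primrec_two_pow (Primrec.fst.comp hx))) ?_)
  unfold Primrec₂
  exact primrec_sum (Primrec.list_length.comp (Primrec.snd.comp (hx.comp Primrec.fst)))
    (primrec_int_mul
      (primrec_entry (Primrec.snd.comp (hc.comp (Primrec.fst.comp Primrec.fst))) (Primrec.const 0)
        Primrec.snd)
      (primrec_entry (Primrec.snd.comp (hx.comp (Primrec.fst.comp Primrec.fst))) Primrec.snd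
        (Primrec.snd.comp Primrec.fst)))

open Classical in
/-- The inequality, if any, that a certificate proves to be equivalent to an instance. -/
noncomputable def tryCert (x : ℕ × List (List ℤ)) (c : Cert) : Option (ℕ × List ℤ) :=
  if NegCheck x c then some (0, []) else if PosCheck x c then some (query x c) else none

theorem primrec_tryCert : Primrec₂ tryCert := by
  classical
  have h : Primrec fun p : (ℕ × List (List ℤ)) × Cert => if NegCheck p.1 p.2 then some (0, [])
      else if PosCheck p.1 p.2 then some (query p.1 p.2) else none :=
    Primrec.ite (primrecPred_negCheck Primrec.fst Primrec.snd) (Primrec.const _)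
      (Primrec.ite (primrecPred_posCheck Primrec.fst Primrec.snd)
        (Primrec.option_some.comp (primrec_query Primrec.fst Primrec.snd)) (Primrec.const _))
  refine h.of_eq fun p => ?_
  unfold tryCert
  congr!

theorem tryCert_sound {x : ℕ × List (List ℤ)} {c : Cert} {y : ℕ × List ℤ}
    (h : tryCert x c = some y) : GroupBalancedMaxIIP entropicRegion x ↔ IIP entropicRegion y := by
  unfold tryCert at h
  split_ifs at h with h1 h2
  · rw [← Option.some.inj h]
    exact iff_of_false h1.not_groupBalancedMaxIIP (not_iip_nil _)
  · rw [← Option.some.inj h]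
    exact h2.groupBalancedMaxIIP_iff

theorem exists_tryCert (x : ℕ × List (List ℤ)) : ∃ c y, tryCert x c = some y := by
  obtain ⟨c, hc⟩ := exists_check x
  by_cases h : NegCheck x c
  · exact ⟨c, _, if_pos h⟩
  · exact ⟨c, _, (if_neg h).trans (if_pos (hc.resolve_left h))⟩

/-- Unbounded search over codes of certificates halts by completeness (`exists_tryCert`), and
whichever certificate is found first yields an equivalent inequality by soundness (`tryCert_sound`).
-/
theorem exists_computable_reduction : ∃ r : ℕ × List (List ℤ) → ℕ × List ℤ, Computable r ∧
    ∀ x, GroupBalancedMaxIIP entropicRegion x ↔ IIP entropicRegion (r x) := by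
  let f : ℕ × List (List ℤ) → ℕ → Option (ℕ × List ℤ) := fun x m =>
    (Encodable.decode m : Option Cert).bind (tryCert x)
  have hf : Primrec₂ f := Primrec.option_bind (Primrec.decode.comp Primrec.snd)
    (primrec_tryCert.comp (Primrec.fst.comp Primrec.fst) Primrec.snd)
  have hdom : ∀ x, (Nat.rfindOpt (f x)).Dom := fun x => by
    obtain ⟨c, y, h⟩ := exists_tryCert x
    exact Nat.rfindOpt_dom.2 ⟨Encodable.encode c, y, by simp only [f, Encodable.encodek]; exact h⟩
  refine ⟨fun x => (Nat.rfindOpt (f x)).get (hdom x),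
    (Partrec.rfindOpt hf.to_comp).of_eq_tot fun x => Part.get_mem _, fun x => ?_⟩
  obtain ⟨m, hm⟩ := Nat.rfindOpt_spec (Part.get_mem (hdom x))
  obtain ⟨c, -, hc⟩ := Option.bind_eq_some_iff.1 hm
  exact tryCert_sound hc

theorem turingReducible_groupBalancedMaxIIP_iip : TuringReducible
    (charFun (GroupBalancedMaxIIP entropicRegion)) (charFun (IIP entropicRegion)) := by
  obtain ⟨r, hr, h⟩ := exists_computable_reduction
  exact turingReducible_charFun hr (not_iip_nil _) h

end Search

end InfoIneq

theorem mainTheorem4 :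
    TuringEquivalent
      (InfoIneq.charFun (InfoIneq.GroupBalancedMaxIIP InfoIneq.entropicRegion))
      (InfoIneq.charFun (InfoIneq.IIP InfoIneq.entropicRegion)) ∧
    TuringEquivalent
      (InfoIneq.charFun (InfoIneq.GroupBalancedMaxIIP InfoIneq.almostEntropicRegion))
      (InfoIneq.charFun (InfoIneq.IIP InfoIneq.almostEntropicRegion)) := by
  rw [InfoIneq.iip_almostEntropicRegion, InfoIneq.groupBalancedMaxIIP_almostEntropicRegion,
    and_self_iff]
  exact ⟨InfoIneq.turingReducible_groupBalancedMaxIIP_iip,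
    InfoIneq.turingReducible_iip_groupBalancedMaxIIP⟩
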